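/- **Notation.** $\mathscr D$ is the space of compactly supported $C^\infty$ functions $\mathbb R\to\mathbb C$, and $L_{p,loc}$ the space of measurable functions $\mathbb R\to\mathbb C$ that lie in $L_p(K)$ for every compact $K\subset\mathbb R$. If one of $f,g$ is in $\mathscr D$ and the other is locally integrable, put $\langle f,g\rangle:=\int_{\mathbb R} f(\xi)\overline{g(\xi)}\,d\xi$. Locally integrable $h_j$ tend to $h$ *in the sense of distributions* if $\langle h_j,f\rangle\to\langle h,f\rangle$ for all $f\in\mathscr D$. For $\lambda\in\mathbb R\setminus\{0\}$ and $k\in\mathbb Z$ put $f_{\lambda;0,k}(\xi):=|\lambda|^{1/2}e^{-ik\lambda\xi}f(\lambda\xi)$. For a $2\pi$-periodic trigonometric polynomial $a(\xi)=\sum_k a(k)e^{-ik\xi}$ let $\deg(a):=\max\{|k|:a(k)\neq0\}$ and let $\|a\|_\infty$ be its essential supremum norm on $[-\pi,\pi]$. Let $\{\lambda_j\}_{j\ge0}$ be nonzero reals, $J\ge0$ an integer, and let $\Phi=\{\varphi^{1},\dots,\varphi^{r}\}$, $\tilde\Phi=\{\tilde\varphi^{1},\dots,\tilde\varphi^{r}\}$,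 $\Psi^j=\{\psi^{j,1},\dots,\psi^{j,s_j}\}$, $\tilde\Psi^j=\{\tilde\psi^{j,1},\dots,\tilde\psi^{j,s_j}\}$ ($j\ge J$) be finite families of locally integrable functions. The pair of systems generated by $(\Phi;\{\Psi^j\}_{j\ge J})$ and $(\tilde\Phi;\{\tilde\Psi^j\}_{j\ge J})$ is a *pair of frequency-based nonstationary dual wavelet frames in $\mathscr D'$* (starting at level $J$) if for all $f,g\in\mathscr D$ the series $\sum_{k\in\mathbb Z}\langle f,\varphi^{\ell}_{\lambda_J;0,k}\rangle\langle\tilde\varphi^{\ell}_{\lambda_J;0,k},g\rangle$ and $\sum_{k\in\mathbb Z}\langle f,\psi^{j,\ell}_{\lambda_j;0,k}\rangle\langle\tilde\psi^{j,\ell}_{\lambda_j;0,k},g\rangle$ converge absolutely for all $\ell$ and all $j\ge J$, and $$\lim_{J'\to+\infty}\Big(\sum_{\ell=1}^{r}\sum_{k\in\mathbb Z}\langle f,\varphi^{\ell}_{\lambda_J;0,k}\rangle\langle\tilde\varphi^{\ell}_{\lambda_J;0,k},g\rangle+\sum_{j=J}^{J'-1}\sum_{\ell=1}^{s_j}\sum_{k\in\mathbb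 Z}\langle f,\psi^{j,\ell}_{\lambda_j;0,k}\rangle\langle\tilde\psi^{j,\ell}_{\lambda_j;0,k},g\rangle\Big)=2\pi\langle f,g\rangle .$$ **Theorem.** Let $\{d_j\}_{j=1}^\infty$ be nonzero integers with $\lim_{j\to\infty}\prod_{n=1}^j|d_n|=\infty$; put $\lambda_0:=1$ and $\lambda_j:=\big(\prod_{n=1}^j d_n\big)^{-1}$ for $j\ge1$. Let $a^j,\tilde a^j$ ($j\ge1$) be $2\pi$-periodic trigonometric polynomials with $a^j(0)=\tilde a^j(0)=1$ for all $j$ and $$\sum_{j=1}^\infty|\lambda_j|\deg(a^j)\|a^j\|_\infty<\infty,\qquad \sum_{j=1}^\infty|\lambda_j|\deg(\tilde a^j)\|\tilde a^j\|_\infty<\infty .$$ (1) For every $j\ge0$ and $\xi\in\mathbb R$ the infinite products $$\varphi^j(\xi):=\prod_{n=1}^\infty a^{j+n}(\lambda_{j+n}\lambda_j^{-1}\xi),\qquad \tilde\varphi^j(\xi):=\prod_{n=1}^\infty\tilde a^{j+n}(\lambda_{j+n}\lambda_j^{-1}\xi)$$ converge, $\varphi^j,\tilde\varphi^j\in L_{\infty,loc}$,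 and for all $j\ge1$ and $\xi\in\mathbb R$ $$\varphi^{j-1}(d_j\xi)=a^j(\xi)\varphi^j(\xi),\qquad \tilde\varphi^{j-1}(d_j\xi)=\tilde a^j(\xi)\tilde\varphi^j(\xi).$$ (2) For $j\ge1$ let $\theta^{j,\ell},\tilde\theta^{j,\ell}$ ($1\le\ell\le r_{j-1}$) and $b^{j,\ell},\tilde b^{j,\ell}$ ($1\le\ell\le s_{j-1}$) be $2\pi$-periodic measurable functions in $L_{2,loc}$. For $j\ge1$ define $$\varphi^{j-1,\ell}(\xi):=\theta^{j,\ell}(\xi)\varphi^{j-1}(\xi),\quad \tilde\varphi^{j-1,\ell}(\xi):=\tilde\theta^{j,\ell}(\xi)\tilde\varphi^{j-1}(\xi),\quad \psi^{j-1,\ell}(d_j\xi):=b^{j,\ell}(\xi)\varphi^j(\xi),\quad \tilde\psi^{j-1,\ell}(d_j\xi):=\tilde b^{j,\ell}(\xi)\tilde\varphi^j(\xi),$$ and $\Theta^j(\xi):=\sum_{\ell=1}^{r_{j-1}}\overline{\theta^{j,\ell}(\xi)}\,\tilde\theta^{j,\ell}(\xi)$. For $j\ge0$ let $\Phi^j=\{\varphi^{j,1},\dots,\varphi^{j,r_j}\}$,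 $\Psi^j=\{\psi^{j,1},\dots,\psi^{j,s_j}\}$, and similarly $\tilde\Phi^j,\tilde\Psi^j$. Then all these functions belong to $L_{2,loc}$. Moreover, for every integer $J\ge0$ the pair of systems generated by $(\Phi^J;\{\Psi^j\}_{j\ge J})$ and $(\tilde\Phi^J;\{\tilde\Psi^j\}_{j\ge J})$ is a pair of frequency-based nonstationary dual wavelet frames in $\mathscr D'$, if and only if, for all $j\ge1$, $$\Theta^j(d_j\xi)\overline{a^j(\xi)}\,\tilde a^j(\xi)+\sum_{\ell=1}^{s_{j-1}}\overline{b^{j,\ell}(\xi)}\,\tilde b^{j,\ell}(\xi)=\Theta^{j+1}(\xi)\qquad\text{for a.e. }\xi\in\mathbb R,$$ $$\Theta^j(d_j\xi)\overline{a^j(\xi)}\,\tilde a^j\big(\xi+\tfrac{2\pi\omega}{d_j}\big)+\sum_{\ell=1}^{s_{j-1}}\overline{b^{j,\ell}(\xi)}\,\tilde b^{j,\ell}\big(\xi+\tfrac{2\pi\omega}{d_j}\big)=0\qquad\text{for a.e. }\xi\in\mathbb R\text{ and all }\omega\in\mathbb Z\setminus d_j\mathbb Z,$$ and $$\lim_{j\to+\infty}\Theta^{j+1}(\lambda_j\,\cdot)=1\quad\text{in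 the sense of distributions.}$$ -/

import Mathlib

open MeasureTheory Filter Topology
open scoped ENNReal ComplexConjugate Distributions

noncomputable section

namespace NonstatOEP

/-- The space `𝒟` of compactly supported smooth functions `ℝ → ℂ`. -/
abbrev TestFun : Type := 𝓓((⊤ : TopologicalSpace.Opens ℝ), ℂ)

/-- `f ∈ L_{p,loc}(ℝ)`: `f` is (Lebesgue) measurable and in `L_p` of every compact set. -/
def MemLpLoc (p : ℝ≥0∞) (f : ℝ → ℂ) : Prop :=
  ∀ K : Set ℝ, IsCompact K → MemLp f p (volume.restrict K)

/-- The pairing `⟨f, g⟩ = ∫ f(ξ) conj(g(ξ)) dξ`. It is used when one of the two functions is a test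
function and the other one is locally integrable, that is, a regular distribution. -/
def pair (f g : ℝ → ℂ) : ℂ := ∫ ξ, f ξ * conj (g ξ)

/-- `f_{lam;k,n}(x) = |lam|^{1/2} e^{-i n lam x} f(lam x - k)`. -/
def tdm (f : ℝ → ℂ) (lam k n : ℝ) (x : ℝ) : ℂ :=
  (Real.sqrt |lam| : ℂ) * Complex.exp (-(Complex.I * n * lam * x)) * f (lam * x - k)

/-- The sequence of functions `h j` tends to `h₀` in the sense of distributions. -/
def TendstoDistrib (h : ℕ → ℝ → ℂ) (h₀ : ℝ → ℂ) : Prop :=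
  ∀ f : TestFun, Tendsto (fun j => pair (h j) f) atTop (𝓝 (pair h₀ f))

/-- The `k`-th term `⟨f, φ_{lam;0,k}⟩ ⟨φ'_{lam;0,k}, g⟩`. -/
def frameTerm (lam : ℝ) (φ φ' : ℝ → ℂ) (f g : TestFun) (k : ℤ) : ℂ :=
  pair f (tdm φ lam 0 k) * pair (tdm φ' lam 0 k) g

/-- The pair of systems generated at the starting level `J` by the scales `lam j` (`j ≥ J`), the
families `Φ = {φ 0, …, φ (r-1)}`, `Φ' = {φ' 0, …, φ' (r-1)}` and, at each level `j ≥ J`,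
`Ψ j = {ψ j 0, …, ψ j (s j - 1)}`, `Ψ' j = {ψ' j 0, …, ψ' j (s j - 1)}`, is a pair of
frequency-based nonstationary dual wavelet frames in the distribution space `𝒟'`.
The generators here are regular distributions. -/
structure IsNonstatDualFrames (lam : ℕ → ℝ) (J : ℕ) {r : ℕ} (φ φ' : Fin r → ℝ → ℂ)
    {s : ℕ → ℕ} (ψ ψ' : ∀ j, Fin (s j) → ℝ → ℂ) : Prop where
  locInt_φ : ∀ l, LocallyIntegrable (φ l) volume
  locInt_φ' : ∀ l, LocallyIntegrable (φ' l) volume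
  locInt_ψ : ∀ j, J ≤ j → ∀ l, LocallyIntegrable (ψ j l) volume
  locInt_ψ' : ∀ j, J ≤ j → ∀ l, LocallyIntegrable (ψ' j l) volume
  summable_φ : ∀ f g : TestFun, ∀ l,
    Summable fun k : ℤ => ‖frameTerm (lam J) (φ l) (φ' l) f g k‖
  summable_ψ : ∀ f g : TestFun, ∀ j, J ≤ j → ∀ l,
    Summable fun k : ℤ => ‖frameTerm (lam j) (ψ j l) (ψ' j l) f g k‖
  tendsto_sum : ∀ f g : TestFun,
    Tendsto
      (fun J' : ℕ =>
        (∑ l, ∑' k : ℤ, frameTerm (lam J) (φ l) (φ' l) f g k) +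
          ∑ j ∈ Finset.Ico J J', ∑ l, ∑' k : ℤ, frameTerm (lam j) (ψ j l) (ψ' j l) f g k)
      atTop (𝓝 (2 * Real.pi * pair f g))

/-- A `2π`-periodic trigonometric polynomial `∑_k a(k) e^{-ikξ}`, given by its finitely many
nonzero coefficients. -/
abbrev TrigPoly : Type := ℤ →₀ ℂ

/-- The value `∑_k a(k) e^{-ikξ}`. -/
def TrigPoly.eval (a : TrigPoly) (ξ : ℝ) : ℂ :=
  ∑ k ∈ a.support, a k * Complex.exp (-(Complex.I * k * ξ))

/-- The degree `max {|k| : a(k) ≠ 0}`. -/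
def TrigPoly.deg (a : TrigPoly) : ℕ := a.support.sup Int.natAbs

/-- The norm of `a` in `L_∞(𝕋)`, the essential supremum of `|a|` over one period
(finite, since `a` is bounded). -/
def TrigPoly.normInf (a : TrigPoly) : ℝ :=
  (eLpNorm a.eval ∞ (volume.restrict (Set.Icc (-Real.pi) Real.pi))).toReal

/-! The sequences below are numbered from `0`: `d j`, `a j`, `θ j`, `b j` and `Θ j` are the
`(j+1)`-st terms of sequences that are usually numbered from `1`. The scales `lam j`, the functions
`φ^j` and the families `Φ^j`, `Ψ^j` are numbered from `0` in either convention. -/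

/-- `lam j = (d 0 ⋯ d (j-1))⁻¹`, and `lam 0 = 1`. -/
def scale (d : ℕ → ℤ) (j : ℕ) : ℝ := (∏ n ∈ Finset.range j, (d n : ℝ))⁻¹

/-- The `n`-th factor (`n = 0, 1, …`) `a_{j+n}(lam (j+n+1) (lam j)⁻¹ ξ)` of `φ^j(ξ)`. -/
def refFactor (d : ℕ → ℤ) (a : ℕ → TrigPoly) (j : ℕ) (ξ : ℝ) (n : ℕ) : ℂ :=
  (a (j + n)).eval (scale d (j + n + 1) * (scale d j)⁻¹ * ξ)

/-- The infinite product `φ^j(ξ)`. -/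
def refFun (d : ℕ → ℤ) (a : ℕ → TrigPoly) (j : ℕ) (ξ : ℝ) : ℂ :=
  ∏' n : ℕ, refFactor d a j ξ n

/-- The generators `φ^{j,l}(ξ) = θ^{j,l}(ξ) φ^j(ξ)`. -/
def genPhi (d : ℕ → ℤ) (a : ℕ → TrigPoly) {r : ℕ → ℕ} (θ : ∀ j, Fin (r j) → ℝ → ℂ)
    (j : ℕ) (l : Fin (r j)) (ξ : ℝ) : ℂ :=
  θ j l ξ * refFun d a j ξ

/-- The generators `ψ^{j,l}`, with `ψ^{j,l}(d_j ξ) = b^{j,l}(ξ) φ^{j+1}(ξ)`. -/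
def genPsi (d : ℕ → ℤ) (a : ℕ → TrigPoly) {s : ℕ → ℕ} (b : ∀ j, Fin (s j) → ℝ → ℂ)
    (j : ℕ) (l : Fin (s j)) (ξ : ℝ) : ℂ :=
  b j l (ξ / d j) * refFun d a (j + 1) (ξ / d j)

/-- `Θ^j(ξ) = ∑_l conj(θ^{j,l}(ξ)) θ'^{j,l}(ξ)`. -/
def bigTheta {r : ℕ → ℕ} (θ θ' : ∀ j, Fin (r j) → ℝ → ℂ) (j : ℕ) (ξ : ℝ) : ℂ :=
  ∑ l, conj (θ j l ξ) * θ' j l ξ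

/-- A family of `2π`-periodic measurable functions in `L_{2,loc}(ℝ)`. -/
def IsFilterFamily {r : ℕ → ℕ} (θ : ∀ j, Fin (r j) → ℝ → ℂ) : Prop :=
  ∀ j l, Function.Periodic (θ j l) (2 * Real.pi) ∧ MemLpLoc 2 (θ j l)

end NonstatOEP

end

open NonstatOEP

/-! In the variable `x` with `ξ = λ_J x`, the functions `φ^J(λ_J x)` are the tails of one infinite
product. A Bernstein inequality in the complex plane turns the summability hypothesis into locally
uniform convergence there. So each tail is entire (`IsMaskSeq.differentiable_tailProd`), equals 1 at
0, hence is nonzero almost everywhere on the line, and tends to 1 uniformly on discs as `J → ∞`.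

Since the generators lie in `L_{2,loc}`, Parseval on cells of length `2π/|λ|` rewrites each frame
sum as `2π` times a sum over `m` of integrals pairing `x` with `x + 2πm/λ` (`hasSum_frameTerm`).
Absolute convergence comes for free. By the refinement equation, (sum of `Φ^j`) + (sum of `Ψ^j`) -
(sum of `Φ^{j+1}`) becomes a sum over `m` of integrals of an a.e. nonzero kernel times the defect of
the reconstruction equations (`OEPData.hasSum_defectKernel`). Localised test functions isolate each
`m`, so the difference vanishes for all `f, g` exactly when all defects vanish a.e.
(`OEPData.ae_defect_eq_zero_of_sum_eq`, `OEPData.sum_eq_of_ae_defect_eq_zero`).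

Comparing the starting levels `J` and `J + 1` shows that frames at every level force this one-step
identity. With it the partial sums telescope to the sum of `Φ^{J'}`. At fine scales only `m = 0`
survives there, leaving `Θ^{J'}(λ_{J'} x)` times the product of the conjugated tail and the dual
tail, tested on `f · conj g`. Removing these tails from the limit is the delicate point, since `Θ`
converges only as distributions: the tails are holomorphic and tend to 1 uniformly on discs, and a
uniform boundedness argument on `ℓ¹` shows that such factors do not affect the limit
(`tendsto_integral_mul_hol`, `OEPData.tendsto_Th_iff`). -/

noncomputable section

namespace NonstatOEP

/-! ### Trigonometric polynomials in the complex plane. -/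

namespace TrigPoly

/-- The entire extension of a trigonometric polynomial. -/
def evalC (a : TrigPoly) (z : ℂ) : ℂ :=
  ∑ k ∈ a.support, a k * Complex.exp (-(Complex.I * k * z))

lemma evalC_ofReal (a : TrigPoly) (x : ℝ) : evalC a x = a.eval x := rfl

lemma differentiable_evalC (a : TrigPoly) : Differentiable ℂ (evalC a) := by
  unfold evalC; fun_prop

lemma continuous_eval (a : TrigPoly) : Continuous a.eval := by
  unfold eval; fun_prop

lemma eval_add_int_mul (a : TrigPoly) (x : ℝ) (m : ℤ) :
    a.eval (x + 2 * Real.pi * m) = a.eval x := by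
  unfold eval
  refine Finset.sum_congr rfl fun k _ => ?_
  congr 1
  rw [Complex.exp_eq_exp_iff_exists_int]
  refine ⟨-(k * m), ?_⟩
  push_cast
  ring

lemma eval_periodic (a : TrigPoly) : Function.Periodic a.eval (2 * Real.pi) := fun x => by
  simpa using a.eval_add_int_mul x 1

lemma eLpNorm_eval_ne_top (a : TrigPoly) :
    eLpNorm a.eval ∞ (volume.restrict (Set.Icc (-Real.pi) Real.pi)) ≠ ∞ := by
  obtain ⟨C, hC⟩ := isCompact_Icc.exists_bound_of_continuousOn
    (s := Set.Icc (-Real.pi) Real.pi) a.continuous_eval.continuousOn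
  refine ne_top_of_le_ne_top (ENNReal.ofReal_ne_top (r := C)) ?_
  rw [eLpNorm_exponent_top]
  refine eLpNormEssSup_le_of_ae_bound ?_
  filter_upwards [ae_restrict_mem measurableSet_Icc] with x hx using hC x hx

/-- Continuity upgrades the essential bound to a pointwise one: `max ‖a‖ M` and `M` are continuous
and agree a.e. on one period, hence everywhere on it; periodicity does the rest. -/
lemma norm_eval_le_normInf (a : TrigPoly) (x : ℝ) : ‖a.eval x‖ ≤ a.normInf := by
  have hae : ∀ᵐ x ∂(volume.restrict (Set.Icc (-Real.pi) Real.pi)), ‖a.eval x‖ ≤ a.normInf := by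
    have h := ae_le_eLpNormEssSup (f := a.eval)
      (μ := volume.restrict (Set.Icc (-Real.pi) Real.pi))
    filter_upwards [h] with x hx
    rw [← eLpNorm_exponent_top] at hx
    have := ENNReal.toReal_mono a.eLpNorm_eval_ne_top hx
    simpa [normInf] using this
  have heq : Set.EqOn (fun x => max ‖a.eval x‖ a.normInf) (fun _ => a.normInf)
      (Set.Icc (-Real.pi) Real.pi) := by
    refine Measure.eqOn_Icc_of_ae_eq volume (by linarith [Real.pi_pos]) ?_ ?_ ?_
    · filter_upwards [hae] with x hx using max_eq_right hx
    · exact (a.continuous_eval.norm.max continuous_const).continuousOn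
    · exact continuousOn_const
  obtain ⟨y, hy, hxy⟩ := a.eval_periodic.exists_mem_Ico (by positivity) x (-Real.pi)
  rw [hxy]
  have := heq (x := y) ⟨hy.1, by linarith [hy.2]⟩
  exact max_eq_right_iff.1 this

lemma normInf_nonneg (a : TrigPoly) : 0 ≤ a.normInf := ENNReal.toReal_nonneg

lemma natAbs_le_deg (a : TrigPoly) {k : ℤ} (hk : k ∈ a.support) : k.natAbs ≤ a.deg :=
  Finset.le_sup (f := Int.natAbs) hk

/-- An exponential sum with frequencies at most `n` that is bounded by `M` on the real line is
bounded by `M e^{n |Im z|}` in the lower half plane. -/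
lemma norm_expSum_le_of_im_nonpos {S : Finset ℤ} {c : ℤ → ℂ} {e : ℤ → ℤ} {n : ℕ} {M : ℝ}
    (he : ∀ k ∈ S, (e k).natAbs ≤ n)
    (hM : ∀ x : ℝ, ‖∑ k ∈ S, c k * Complex.exp (-(Complex.I * e k * x))‖ ≤ M)
    {z : ℂ} (hz : z.im ≤ 0) :
    ‖∑ k ∈ S, c k * Complex.exp (-(Complex.I * e k * z))‖ ≤ M * Real.exp (n * |z.im|) := by
  -- With `w = e^{-iz}`, multiplying by `w^n` clears the negative frequencies and leaves a
  -- polynomial. The lower half plane goes into the closed unit disc, where the maximum principle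
  -- applies; undoing the factor `e^{-inz}` costs `e^{n|Im z|}`.
  set P : ℂ → ℂ := fun w => ∑ k ∈ S, c k * w ^ (e k + n).toNat with hP
  have hPexp : ∀ z : ℂ, P (Complex.exp (-(Complex.I * z))) =
      Complex.exp (-(Complex.I * n * z)) * ∑ k ∈ S, c k * Complex.exp (-(Complex.I * e k * z)) := by
    intro z
    rw [hP, Finset.mul_sum]
    refine Finset.sum_congr rfl fun k hk => ?_
    have h1 : ((e k + n).toNat : ℂ) = e k + n := by
      rw [← Int.cast_natCast, Int.toNat_of_nonneg (by have := he k hk; omega)]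
      push_cast
      rfl
    rw [← Complex.exp_nat_mul, h1, mul_left_comm, ← Complex.exp_add]
    congr 2
    ring
  have hsph : ∀ w ∈ frontier (Metric.ball (0 : ℂ) 1), ‖P w‖ ≤ M := by
    intro w hw
    rw [frontier_ball _ one_ne_zero, mem_sphere_zero_iff_norm] at hw
    obtain ⟨t, ht⟩ := (Complex.norm_eq_one_iff w).1 hw
    have : w = Complex.exp (-(Complex.I * ((-t : ℝ) : ℂ))) := by
      rw [← ht]; push_cast; ring_nf
    rw [this, hPexp, norm_mul]
    have h1 : ‖Complex.exp (-(Complex.I * n * ((-t : ℝ) : ℂ)))‖ = 1 := by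
      rw [Complex.norm_exp]; simp
    rw [h1, one_mul]
    exact hM _
  have hdiff : Differentiable ℂ P := by
    rw [hP]; fun_prop
  have hw : ‖P (Complex.exp (-(Complex.I * z)))‖ ≤ M := by
    refine Complex.norm_le_of_forall_mem_frontier_norm_le Metric.isBounded_ball
      hdiff.diffContOnCl hsph ?_
    rw [closure_ball _ one_ne_zero, mem_closedBall_zero_iff, Complex.norm_exp]
    simpa using hz
  rw [hPexp, norm_mul, Complex.norm_exp] at hw
  have h2 : (-(Complex.I * n * z)).re = -(n * |z.im|) := by
    rw [abs_of_nonpos hz]; simp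
  rw [h2, Real.exp_neg, inv_mul_le_iff₀ (Real.exp_pos _)] at hw
  linarith

/-- The upper half plane reduces to the lower one by replacing `z` by `-z` and negating all
frequencies. -/
lemma norm_evalC_le (a : TrigPoly) (z : ℂ) :
    ‖evalC a z‖ ≤ a.normInf * Real.exp (a.deg * |z.im|) := by
  rcases le_total z.im 0 with hz | hz
  · exact norm_expSum_le_of_im_nonpos (e := id) (fun k hk => a.natAbs_le_deg hk)
      (fun x => a.norm_eval_le_normInf x) hz
  · have h := norm_expSum_le_of_im_nonpos (S := a.support) (c := a) (e := fun k => -k) (n := a.deg)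
      (M := a.normInf) (fun k hk => by simpa using a.natAbs_le_deg hk)
      (fun x => by
        have := a.norm_eval_le_normInf (-x)
        simpa [eval] using this) (z := -z) (by simpa using hz)
    simpa [evalC] using h

/-- A Bernstein inequality in the complex plane. -/
lemma norm_deriv_evalC_le (a : TrigPoly) (z : ℂ) :
    ‖deriv (evalC a) z‖ ≤ a.deg * a.normInf * Real.exp (a.deg * |z.im| + 1) := by
  -- In degree 0 the radius `1/deg` used below is not available; the growth bound then makes the
  -- function bounded, hence constant by Liouville.
  rcases Nat.eq_zero_or_pos a.deg with h0 | hpos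
  · have hb : Bornology.IsBounded (Set.range (evalC a)) := by
      rw [isBounded_iff_forall_norm_le]
      refine ⟨a.normInf, ?_⟩
      rintro _ ⟨w, rfl⟩
      simpa [h0] using a.norm_evalC_le w
    have : evalC a = fun _ => evalC a 0 :=
      funext fun w => a.differentiable_evalC.apply_eq_apply_of_bounded hb w 0
    rw [this]
    simp [h0]
  · have hn : (0 : ℝ) < a.deg := by exact_mod_cast hpos
    -- Cauchy's estimate on the circle of radius `1/deg`: the exponent `deg * |Im|` grows by at most
    -- 1 there.
    have h := Complex.norm_deriv_le_of_forall_mem_sphere_norm_le (c := z) (f := evalC a)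
      (C := a.normInf * Real.exp (a.deg * |z.im| + 1)) (inv_pos.2 hn)
      a.differentiable_evalC.diffContOnCl (fun w hw => ?_)
    · refine h.trans_eq ?_
      rw [div_inv_eq_mul]; ring
    · refine (a.norm_evalC_le w).trans ?_
      refine mul_le_mul_of_nonneg_left ?_ a.normInf_nonneg
      rw [Real.exp_le_exp]
      have h1 : |w.im| ≤ |z.im| + (a.deg : ℝ)⁻¹ := by
        have h2 : |w.im - z.im| ≤ (a.deg : ℝ)⁻¹ := by
          rw [← Complex.sub_im]
          refine (Complex.abs_im_le_norm _).trans_eq ?_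
          rw [← dist_eq_norm]; exact hw
        have := abs_sub_abs_le_abs_sub w.im z.im
        linarith
      calc (a.deg : ℝ) * |w.im| ≤ a.deg * (|z.im| + (a.deg : ℝ)⁻¹) := by gcongr
        _ = _ := by field_simp

lemma norm_evalC_sub_le (a : TrigPoly) (z : ℂ) :
    ‖evalC a z - evalC a 0‖ ≤ a.deg * a.normInf * Real.exp (a.deg * ‖z‖ + 1) * ‖z‖ := by
  have h := (convex_closedBall (0 : ℂ) ‖z‖).norm_image_sub_le_of_norm_deriv_le (f := evalC a)
    (C := a.deg * a.normInf * Real.exp (a.deg * ‖z‖ + 1)) (x := 0) (y := z)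
    (fun w _ => a.differentiable_evalC w) (fun w hw => ?_) (by simp) (by simp)
  · simpa using h
  · refine (a.norm_deriv_evalC_le w).trans ?_
    have hw' : |w.im| ≤ ‖z‖ := (Complex.abs_im_le_norm w).trans (by simpa using hw)
    have := a.normInf_nonneg
    gcongr

lemma one_le_normInf (a : TrigPoly) (h0 : a.eval 0 = 1) : 1 ≤ a.normInf := by
  simpa [h0] using a.norm_eval_le_normInf 0

end TrigPoly

/-! ### Scales and the infinite products as entire functions. -/

lemma prod_cast_ne_zero {d : ℕ → ℤ} (hd : ∀ j, d j ≠ 0) (j : ℕ) :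
    ∏ n ∈ Finset.range j, (d n : ℝ) ≠ 0 :=
  Finset.prod_ne_zero_iff.2 fun n _ => Int.cast_ne_zero.2 (hd n)

lemma scale_ne_zero {d : ℕ → ℤ} (hd : ∀ j, d j ≠ 0) (j : ℕ) : scale d j ≠ 0 :=
  inv_ne_zero (prod_cast_ne_zero hd j)

lemma scale_succ_mul {d : ℕ → ℤ} (hd : ∀ j, d j ≠ 0) (j : ℕ) :
    scale d (j + 1) * d j = scale d j := by
  have h1 := prod_cast_ne_zero hd j
  have h2 : (d j : ℝ) ≠ 0 := Int.cast_ne_zero.2 (hd j)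
  rw [scale, scale, Finset.prod_range_succ]
  field_simp

lemma tendsto_scale {d : ℕ → ℤ}
    (hd_lim : Tendsto (fun j => ∏ n ∈ Finset.range j, |d n|) atTop atTop) :
    Tendsto (scale d) atTop (𝓝 0) := by
  rw [tendsto_zero_iff_abs_tendsto_zero]
  have h : Tendsto (fun j => ((∏ n ∈ Finset.range j, |d n| : ℤ) : ℝ)) atTop atTop :=
    tendsto_intCast_atTop_atTop.comp hd_lim
  refine (tendsto_inv_atTop_zero.comp h).congr fun j => ?_
  simp [scale, Finset.abs_prod]

/-- The infinite product `∏_{n ≥ J} a_n(scale (n+1) z)`, the entire extension of `φ^J(scale J z)`. -/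
def tailProd (d : ℕ → ℤ) (a : ℕ → TrigPoly) (J : ℕ) (z : ℂ) : ℂ :=
  ∏' n : ℕ, (a (J + n)).evalC (scale d (J + n + 1) * z)

/-- The hypotheses on the masks under which the infinite products converge. -/
structure IsMaskSeq (d : ℕ → ℤ) (a : ℕ → TrigPoly) : Prop where
  eval_zero : ∀ j, (a j).eval 0 = 1
  summable : Summable fun j => |scale d (j + 1)| * (a j).deg * (a j).normInf

/-- The weights that control the convergence of the infinite products. -/
def maskWeight (d : ℕ → ℤ) (a : ℕ → TrigPoly) (j : ℕ) : ℝ :=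
  |scale d (j + 1)| * (a j).deg * (a j).normInf

lemma maskWeight_nonneg (d : ℕ → ℤ) (a : ℕ → TrigPoly) (j : ℕ) : 0 ≤ maskWeight d a j := by
  have := (a j).normInf_nonneg
  unfold maskWeight; positivity

/-- The constant in the estimate of the factors on the disc of radius `R`. -/
def maskConst (d : ℕ → ℤ) (a : ℕ → TrigPoly) (R : ℝ) : ℝ :=
  R * Real.exp ((∑' j, maskWeight d a j) * R + 1)

/-- An upper bound for `|tailProd d a J z - 1|` on the disc of radius `R`. -/
def tailBound (d : ℕ → ℤ) (a : ℕ → TrigPoly) (R : ℝ) (J : ℕ) : ℝ :=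
  Real.exp (∑' n, maskWeight d a (J + n) * maskConst d a R) - 1

lemma tendsto_tailBound (d : ℕ → ℤ) (a : ℕ → TrigPoly) (R : ℝ) :
    Tendsto (tailBound d a R) atTop (𝓝 0) := by
  have h1 : Tendsto (fun J => ∑' n, maskWeight d a (J + n)) atTop (𝓝 0) := by
    simpa [add_comm] using tendsto_sum_nat_add (maskWeight d a)
  have h2 : Tendsto (fun J => Real.exp (∑' n, maskWeight d a (J + n) * maskConst d a R) - 1)
      atTop (𝓝 (Real.exp (0 * maskConst d a R) - 1)) := by
    simp_rw [tsum_mul_right]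
    exact ((Real.continuous_exp.tendsto _).comp (h1.mul_const _)).sub_const _
  rw [zero_mul, Real.exp_zero, sub_self] at h2
  exact h2

namespace IsMaskSeq

variable {d : ℕ → ℤ} {a : ℕ → TrigPoly}

lemma summable_maskWeight (h : IsMaskSeq d a) : Summable (maskWeight d a) := h.summable

lemma summable_add (h : IsMaskSeq d a) (J : ℕ) : Summable fun n => maskWeight d a (J + n) :=
  h.summable_maskWeight.comp_injective (add_right_injective J)

/-- The exponential in the Bernstein estimate is bounded uniformly in `j`: since `normInf ≥ 1`, the
product of degree and scale is at most one weight, hence at most their total sum. What remains is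
the summable weight times a constant. -/
lemma norm_factor_sub_one_le (h : IsMaskSeq d a) (j : ℕ) {R : ℝ} {z : ℂ} (hz : ‖z‖ ≤ R) :
    ‖(a j).evalC (scale d (j + 1) * z) - 1‖ ≤ maskWeight d a j * maskConst d a R := by
  have h0 : (a j).evalC 0 = 1 := by
    have := TrigPoly.evalC_ofReal (a j) 0
    rw [h.eval_zero] at this
    simpa using this
  have h1 := (a j).norm_evalC_sub_le (scale d (j + 1) * z)
  rw [h0] at h1
  refine h1.trans ?_
  have hR : 0 ≤ R := (norm_nonneg z).trans hz
  have hn : ‖((scale d (j + 1) : ℝ) : ℂ) * z‖ = |scale d (j + 1)| * ‖z‖ := by simp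
  have hM := (a j).one_le_normInf (h.eval_zero j)
  have hw : (a j).deg * |scale d (j + 1)| ≤ ∑' j, maskWeight d a j := by
    refine le_trans ?_ (h.summable_maskWeight.le_tsum j fun i _ => maskWeight_nonneg d a i)
    rw [maskWeight, mul_comm]
    exact le_mul_of_one_le_right (by positivity) hM
  rw [hn]
  calc (a j).deg * (a j).normInf * Real.exp ((a j).deg * (|scale d (j + 1)| * ‖z‖) + 1)
        * (|scale d (j + 1)| * ‖z‖)
      = maskWeight d a j * (‖z‖ * Real.exp ((a j).deg * |scale d (j + 1)| * ‖z‖ + 1)) := by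
        rw [maskWeight, mul_assoc ((a j).deg : ℝ) |_| ‖z‖]; ring
    _ ≤ _ := by
        have := maskWeight_nonneg d a j
        have : 0 ≤ ∑' j, maskWeight d a j := tsum_nonneg (maskWeight_nonneg d a)
        unfold maskConst
        gcongr

lemma summable_norm_factor (h : IsMaskSeq d a) (J : ℕ) (z : ℂ) :
    Summable fun n => ‖(a (J + n)).evalC (scale d (J + n + 1) * z) - 1‖ :=
  ((h.summable_add J).mul_right (maskConst d a ‖z‖)).of_nonneg_of_le (fun _ => norm_nonneg _)
    fun n => h.norm_factor_sub_one_le (J + n) le_rfl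

lemma multipliable (h : IsMaskSeq d a) (J : ℕ) (z : ℂ) :
    Multipliable fun n => (a (J + n)).evalC (scale d (J + n + 1) * z) := by
  simpa using multipliable_one_add_of_summable (h.summable_norm_factor J z)

/-- The factor estimate gives locally uniform convergence on a ball around the origin containing the
point, so Weierstrass' theorem applies. -/
lemma differentiable_tailProd (h : IsMaskSeq d a) (J : ℕ) : Differentiable ℂ (tailProd d a J) := by
  intro z
  have hp := ((h.summable_add J).mul_right (maskConst d a (‖z‖ + 1))).hasProdLocallyUniformlyOn_nat_one_add
    (f := fun n w => (a (J + n)).evalC (scale d (J + n + 1) * w) - 1)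
    (K := Metric.ball (0 : ℂ) (‖z‖ + 1)) Metric.isOpen_ball
    (Eventually.of_forall fun n w hw => h.norm_factor_sub_one_le (J + n)
      (by simpa using (mem_ball_zero_iff.1 hw).le))
    (fun n => by
      have := (a (J + n)).differentiable_evalC.continuous
      fun_prop)
  have hd := hp.differentiableOn (Eventually.of_forall fun s => by
    have := fun n => (a (J + n)).differentiable_evalC
    have hf : Differentiable ℂ fun w : ℂ => ∏ n ∈ s, (1 + ((a (J + n)).evalC (scale d (J + n + 1) * w) - 1)) := by
      refine Differentiable.fun_finsetProd fun n _ => ?_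
      have := (a (J + n)).differentiable_evalC
      fun_prop
    simpa [Finset.prod_fn] using hf.differentiableOn) Metric.isOpen_ball
  have := hd.differentiableAt (x := z) (Metric.isOpen_ball.mem_nhds (by simp))
  simp only [add_sub_cancel] at this
  exact this

/-- Limit of the inequality `|∏ (1 + u_n) - 1| ≤ exp (∑ |u_n|) - 1` for finite products. -/
lemma norm_tailProd_sub_one_le (h : IsMaskSeq d a) (J : ℕ) {R : ℝ} {z : ℂ} (hz : ‖z‖ ≤ R) :
    ‖tailProd d a J z - 1‖ ≤ tailBound d a R J := by
  have hlim := ((h.multipliable J z).hasProd.sub_const 1).norm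
  refine le_of_tendsto hlim (Eventually.of_forall fun s => ?_)
  have h1 := s.norm_prod_one_add_sub_one_le
    (fun n => (a (J + n)).evalC (scale d (J + n + 1) * z) - 1)
  simp only [add_sub_cancel] at h1
  refine h1.trans ?_
  unfold tailBound
  gcongr
  have hs := (h.summable_add J).mul_right (maskConst d a R)
  refine le_trans (Finset.sum_le_sum fun n _ => h.norm_factor_sub_one_le (J + n) hz) ?_
  refine hs.sum_le_tsum _ fun n _ => ?_
  exact (norm_nonneg _).trans (h.norm_factor_sub_one_le (J + n) hz)

lemma tailProd_zero (h : IsMaskSeq d a) (J : ℕ) : tailProd d a J 0 = 1 := by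
  have h0 : ∀ j, (a j).evalC 0 = 1 := fun j => by
    have := TrigPoly.evalC_ofReal (a j) 0
    rw [h.eval_zero] at this
    simpa using this
  simp [tailProd, h0]

lemma tailProd_succ (h : IsMaskSeq d a) (J : ℕ) (z : ℂ) :
    tailProd d a J z = (a J).evalC (scale d (J + 1) * z) * tailProd d a (J + 1) z := by
  have he : ∀ n, J + 1 + n = J + (n + 1) := fun n => by ring
  have h1 := h.multipliable (J + 1) z
  simp only [tailProd, he] at h1 ⊢
  exact tprod_eq_zero_mul' (f := fun n => (a (J + n)).evalC (scale d (J + n + 1) * z)) h1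

/-- The restriction to the line is real analytic with value 1 at 0, so its zeros are the complement
of a codiscrete set, which is null. -/
lemma ae_tailProd_ne_zero (h : IsMaskSeq d a) (J : ℕ) : ∀ᵐ x : ℝ, tailProd d a J x ≠ 0 := by
  have han : AnalyticOnNhd ℝ (fun x : ℝ => tailProd d a J x) Set.univ := fun x _ => by
    have h1 : AnalyticAt ℂ (tailProd d a J) (x : ℂ) := (h.differentiable_tailProd J).analyticAt _
    exact (h1.restrictScalars (𝕜 := ℝ)).comp (Complex.ofRealCLM.analyticAt x)
  have := han.preimage_zero_mem_codiscrete (x := 0) (by simp [h.tailProd_zero J])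
  have h2 := ae_restrict_le_codiscreteWithin (μ := volume) MeasurableSet.univ this
  rw [Measure.restrict_univ] at h2
  exact h2

end IsMaskSeq

lemma refFactor_eq (d : ℕ → ℤ) (a : ℕ → TrigPoly) (J : ℕ) (ξ : ℝ) (n : ℕ) :
    refFactor d a J ξ n = (a (J + n)).evalC (scale d (J + n + 1) * ((ξ / scale d J : ℝ) : ℂ)) := by
  rw [refFactor, ← TrigPoly.evalC_ofReal]
  push_cast
  congr 1
  ring

/-- After rescaling, the level enters only through the index at which the product starts. -/
lemma refFun_eq (d : ℕ → ℤ) (a : ℕ → TrigPoly) (J : ℕ) (ξ : ℝ) :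
    refFun d a J ξ = tailProd d a J ((ξ / scale d J : ℝ) : ℂ) := by
  simp only [refFun, tailProd, refFactor_eq]

lemma refFun_scale_mul {d : ℕ → ℤ} (hd : ∀ j, d j ≠ 0) (a : ℕ → TrigPoly) (J : ℕ) (ξ : ℝ) :
    refFun d a J (scale d J * ξ) = tailProd d a J ξ := by
  rw [refFun_eq, mul_div_cancel_left₀ _ (scale_ne_zero hd J)]

lemma IsMaskSeq.continuous_refFun {d : ℕ → ℤ} {a : ℕ → TrigPoly} (h : IsMaskSeq d a) (J : ℕ) :
    Continuous (refFun d a J) := by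
  have := (h.differentiable_tailProd J).continuous
  rw [show refFun d a J = _ from funext (refFun_eq d a J)]
  fun_prop

lemma IsMaskSeq.refFun_mul {d : ℕ → ℤ} {a : ℕ → TrigPoly} (hd : ∀ j, d j ≠ 0)
    (h : IsMaskSeq d a) (j : ℕ) (ξ : ℝ) :
    refFun d a j (d j * ξ) = (a j).eval ξ * refFun d a (j + 1) ξ := by
  have hs := scale_ne_zero hd (j + 1)
  have h2 : (d j : ℝ) ≠ 0 := Int.cast_ne_zero.2 (hd j)
  have h1 : d j * ξ / scale d j = ξ / scale d (j + 1) := by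
    rw [← scale_succ_mul hd]; field_simp
  rw [refFun_eq, refFun_eq, h1, h.tailProd_succ, ← TrigPoly.evalC_ofReal]
  congr 2
  rw [← Complex.ofReal_mul, mul_div_cancel₀ _ hs]

/-! ### Holomorphic multipliers of test functions and uniform boundedness. -/

/-- The test function given by a smooth function of compact support. -/
def mkTest (f : ℝ → ℂ) (hf : ContDiff ℝ (⊤ : ℕ∞) f) (hc : HasCompactSupport f) : TestFun :=
  ⟨f, hf, hc, fun _ _ => trivial⟩

/-- On the support `G` restricts to a real analytic function; off it the product vanishes locally,
so nothing is needed of `G` outside `U`. -/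
lemma contDiff_mul_of_differentiableOn (f : TestFun) {U : Set ℂ} (hU : IsOpen U)
    (hfU : ∀ x ∈ tsupport f, (x : ℂ) ∈ U) {G : ℂ → ℂ} (hG : DifferentiableOn ℂ G U) :
    ContDiff ℝ (⊤ : ℕ∞) fun x : ℝ => f x * G x := by
  rw [contDiff_iff_contDiffAt]
  intro x
  by_cases hx : x ∈ tsupport f
  · have h1 : AnalyticAt ℂ G (x : ℂ) := hG.analyticAt (hU.mem_nhds (hfU x hx))
    have h2 : AnalyticAt ℝ (fun x : ℝ => G x) x :=
      (h1.restrictScalars (𝕜 := ℝ)).comp (Complex.ofRealCLM.analyticAt x)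
    exact f.contDiff.contDiffAt.mul h2.contDiffAt
  · have h1 : (fun x : ℝ => f x * G x) =ᶠ[𝓝 x] fun _ => 0 := by
      filter_upwards [notMem_tsupport_iff_eventuallyEq.1 hx] with y hy
      rw [hy]; simp
    exact contDiffAt_const.congr_of_eventuallyEq h1

/-- The product of a test function and a function holomorphic near its support. -/
def mulHol (f : TestFun) {U : Set ℂ} (hU : IsOpen U) (hfU : ∀ x ∈ tsupport f, (x : ℂ) ∈ U)
    {G : ℂ → ℂ} (hG : DifferentiableOn ℂ G U) : TestFun :=
  mkTest (fun x => f x * G x) (contDiff_mul_of_differentiableOn f hU hfU hG)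
    (f.hasCompactSupport.mul_right)

lemma _root_.MeasureTheory.LocallyIntegrable.integrable_mul_testFun {u : ℝ → ℂ}
    (hu : LocallyIntegrable u volume) (f : TestFun) : Integrable fun x => u x * f x := by
  simpa [mul_comm] using
    hu.integrable_smul_left_of_hasCompactSupport f.continuous f.hasCompactSupport

lemma lp_one_norm (x : lp (fun _ : ℕ => ℂ) 1) : ‖x‖ = ∑' i, ‖x i‖ := by
  simpa using lp.norm_eq_tsum_rpow (p := 1) (by simp) x

lemma lp_one_summable (x : lp (fun _ : ℕ => ℂ) 1) : Summable fun i => ‖x i‖ := by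
  simpa using (lp.memℓp x).summable (by simp)

section Steinhaus

variable {U : Set ℂ} {F : ℕ → ℂ → ℂ}

lemma summable_norm_lp_mul (hF : ∀ i, ∀ z ∈ U, ‖F i z‖ ≤ 1) (x : lp (fun _ : ℕ => ℂ) 1) {z : ℂ}
    (hz : z ∈ U) : Summable fun i => ‖x i * F i z‖ :=
  (lp_one_summable x).of_nonneg_of_le (fun _ => norm_nonneg _) fun i => by
    rw [norm_mul]; exact mul_le_of_le_one_right (norm_nonneg _) (hF i z hz)

lemma differentiableOn_tsum_lp (hU : IsOpen U) (hF : ∀ i, ∀ z ∈ U, ‖F i z‖ ≤ 1)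
    (hd : ∀ i, DifferentiableOn ℂ (F i) U) (x : lp (fun _ : ℕ => ℂ) 1) :
    DifferentiableOn ℂ (fun z => ∑' i, x i * F i z) U :=
  Complex.differentiableOn_tsum_of_summable_norm (lp_one_summable x) (fun i => (hd i).const_mul _) hU
    fun i z hz => by rw [norm_mul]; exact mul_le_of_le_one_right (norm_nonneg _) (hF i z hz)

/-- The functional `x ↦ ∫ u f ∑ x_i F_i` on `ℓ¹`. -/
def lpFunctional (hU : IsOpen U) (hF : ∀ i, ∀ z ∈ U, ‖F i z‖ ≤ 1)
    (hd : ∀ i, DifferentiableOn ℂ (F i) U) (f : TestFun) (hfU : ∀ x ∈ tsupport f, (x : ℂ) ∈ U)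
    {u : ℝ → ℂ} (hu : LocallyIntegrable u volume) : lp (fun _ : ℕ => ℂ) 1 →L[ℂ] ℂ :=
  LinearMap.mkContinuous
    { toFun := fun x => ∫ t : ℝ, u t * (f t * ∑' i, x i * F i t)
      map_add' := fun x y => by
        have hi := fun x => hu.integrable_mul_testFun
          (mulHol f hU hfU (differentiableOn_tsum_lp hU hF hd x))
        refine Eq.trans ?_ (integral_add (hi x) (hi y))
        refine integral_congr_ae (Eventually.of_forall fun t => ?_)
        change u t * (f t * ∑' i, (x i + y i) * F i t) =
          u t * (f t * ∑' i, x i * F i t) + u t * (f t * ∑' i, y i * F i t)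
        -- The series is only known to converge on `U`; away from the support the factor `f t` makes
        -- its value irrelevant.
        by_cases ht : t ∈ tsupport f
        · have h1 := (summable_norm_lp_mul hF x (hfU t ht)).of_norm
          have h2 := (summable_norm_lp_mul hF y (hfU t ht)).of_norm
          simp only [add_mul, h1.tsum_add h2]
          ring
        · simp [image_eq_zero_of_notMem_tsupport ht]
      map_smul' := fun c x => by
        rw [RingHom.id_apply, smul_eq_mul, ← integral_const_mul]
        refine integral_congr_ae (Eventually.of_forall fun t => ?_)
        simp only [lp.coeFn_smul, Pi.smul_apply, smul_eq_mul, mul_assoc, tsum_mul_left]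
        ring }
    (∫ t : ℝ, ‖u t * f t‖) fun x => by
      simp only [LinearMap.coe_mk, AddHom.coe_mk]
      rw [← integral_mul_const]
      refine norm_integral_le_of_norm_le ((hu.integrable_mul_testFun f).norm.mul_const _)
        (Eventually.of_forall fun t => ?_)
      by_cases ht : t ∈ tsupport f
      · rw [← mul_assoc, norm_mul]
        refine mul_le_mul_of_nonneg_left ?_ (norm_nonneg _)
        have h1 := summable_norm_lp_mul hF x (hfU t ht)
        rw [lp_one_norm]
        refine (norm_tsum_le_tsum_norm h1).trans (h1.tsum_le_tsum (fun i => ?_) (lp_one_summable x))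
        rw [norm_mul]; exact mul_le_of_le_one_right (norm_nonneg _) (hF i _ (hfU t ht))
      · simp [image_eq_zero_of_notMem_tsupport ht]

/-- If the distributions `u_j` are pointwise bounded on test functions, and `E_j` are holomorphic
and tend to `0` uniformly near the support of `f`, then `⟨u_j, f E_j⟩` tends to `0`. -/
theorem tendsto_integral_mul_hol {u : ℕ → ℝ → ℂ} (hu : ∀ j, LocallyIntegrable (u j) volume)
    (hbdd : ∀ f : TestFun, ∃ C, ∀ j, ‖∫ x, u j x * f x‖ ≤ C) (f : TestFun)
    (hU : IsOpen U) (hfU : ∀ x ∈ tsupport f, (x : ℂ) ∈ U) {E : ℕ → ℂ → ℂ}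
    (hE : ∀ j, DifferentiableOn ℂ (E j) U) {ε : ℕ → ℝ} (hpos : ∀ j, 0 < ε j)
    (hle : ∀ j, ∀ z ∈ U, ‖E j z‖ ≤ ε j) (hε : Tendsto ε atTop (𝓝 0)) :
    Tendsto (fun j => ∫ x : ℝ, u j x * (f x * E j x)) atTop (𝓝 0) := by
  -- After normalisation, every `ℓ¹` combination of the `F i` is holomorphic on `U`, so its product
  -- with `f` is again a test function.
  set F : ℕ → ℂ → ℂ := fun j z => E j z / ε j with hFdef
  have hF : ∀ i, ∀ z ∈ U, ‖F i z‖ ≤ 1 := fun i z hz => by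
    rw [hFdef, norm_div, Complex.norm_real, Real.norm_of_nonneg (hpos i).le]
    exact div_le_one_of_le₀ (hle i z hz) (hpos i).le
  have hd : ∀ i, DifferentiableOn ℂ (F i) U := fun i => (hE i).div_const _
  -- Pointwise boundedness on `ℓ¹` is the hypothesis `hbdd` for these products. The resulting
  -- uniform bound, taken at the `j`-th unit vector, bounds the `j`-th integral by `C * ε j`.
  obtain ⟨C, hC⟩ := banach_steinhaus (g := fun j => lpFunctional hU hF hd f hfU (hu j))
    (fun x => hbdd (mulHol f hU hfU (differentiableOn_tsum_lp hU hF hd x)))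
  refine squeeze_zero_norm (fun j => ?_) (by simpa using hε.const_mul C)
  have h1 := ((lpFunctional hU hF hd f hfU (hu j)).le_opNorm (lp.single 1 j 1)).trans
    (mul_le_mul_of_nonneg_right (hC j) (norm_nonneg _))
  have h2 : ‖lp.single (E := fun _ : ℕ => ℂ) 1 j (1 : ℂ)‖ = 1 := by
    rw [lp.norm_single (by simp)]; simp
  have h3 : lpFunctional hU hF hd f hfU (hu j) (lp.single 1 j 1) =
      (∫ x : ℝ, u j x * (f x * E j x)) / ε j := by
    rw [← integral_div]
    change ∫ t : ℝ, u j t * (f t * ∑' i, (lp.single (E := fun _ : ℕ => ℂ) 1 j (1 : ℂ)) i * F i t) = _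
    refine integral_congr_ae (Eventually.of_forall fun t => ?_)
    simp only
    rw [tsum_eq_single j fun i hi => by rw [lp.single_apply_ne _ _ _ hi, zero_mul],
      lp.single_apply_self, hFdef]
    ring
  rw [h2, h3, norm_div, Complex.norm_real, Real.norm_of_nonneg (hpos j).le, mul_one,
    div_le_iff₀ (hpos j)] at h1
  exact h1

end Steinhaus

/-! ### Parseval on one period and the Poisson-type identity. -/

lemma _root_.HasSum.of_eq {ι : Type*} {f g : ι → ℂ} {a b : ℂ} (h : HasSum f a)
    (hf : ∀ i, g i = f i) (hb : b = a) : HasSum g b := by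
  rwa [hb, show g = f from funext hf]

/-- Parseval's identity on one period, in bilinear form. -/
lemma hasSum_parseval {T : ℝ} (hT : 0 < T) (a : ℝ) {F G : ℝ → ℂ}
    (hF : MemLp F 2 (volume.restrict (Set.Ioc a (a + T))))
    (hG : MemLp G 2 (volume.restrict (Set.Ioc a (a + T)))) :
    HasSum (fun k : ℤ => (∫ x in a..a + T, Complex.exp (2 * Real.pi * Complex.I * k * x / T) * F x) *
      (∫ x in a..a + T, Complex.exp (-(2 * Real.pi * Complex.I * k * x / T)) * G x))
      (T * ∫ x in a..a + T, F x * G x) := by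
  have := Fact.mk hT
  have hF' : MemLp (fun x => conj (F x)) 2 (volume.restrict (Set.Ioc a (a + T))) := hF.star
  have h1 := hF'.memLp_liftIoc.haarAddCircle
  have h2 := hG.memLp_liftIoc.haarAddCircle
  have hs := (fourierBasis (T := T)).hasSum_inner_mul_inner h1.toLp h2.toLp
  have hcoef : ∀ (H : ℝ → ℂ) (k : ℤ), fourierCoeff (AddCircle.liftIoc T a H) k =
      (1 / T : ℝ) • ∫ x in a..a + T, Complex.exp (-(2 * Real.pi * Complex.I * k * x / T)) * H x := by
    intro H k
    rw [fourierCoeff_eq_intervalIntegral _ _ a]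
    congr 1
    refine intervalIntegral.integral_congr_ae (ae_of_all _ fun x hx => ?_)
    rw [Set.uIoc_of_le (by linarith)] at hx
    rw [AddCircle.liftIoc_coe_apply hx, smul_eq_mul, fourier_coe_apply]
    congr 2
    push_cast
    ring
  have hT' : (T : ℂ) ≠ 0 := Complex.ofReal_ne_zero.2 hT.ne'
  have hinner : inner ℂ h1.toLp h2.toLp = (T⁻¹ : ℝ) • ∫ x in a..a + T, F x * G x := by
    rw [L2.inner_def, ← AddCircle.integral_liftIoc_eq_intervalIntegral,
      ← AddCircle.integral_haarAddCircle]
    refine integral_congr_ae ?_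
    filter_upwards [h1.coeFn_toLp, h2.coeFn_toLp] with x hx1 hx2
    rw [hx1, hx2, RCLike.inner_apply]
    change AddCircle.liftIoc T a G x * conj (conj (AddCircle.liftIoc T a F x)) =
      AddCircle.liftIoc T a F x * AddCircle.liftIoc T a G x
    rw [RCLike.conj_conj, mul_comm]
  rw [hinner] at hs
  -- Each Fourier coefficient carries a factor `1/T`, and so does the normalised inner product; the
  -- net factor on the right is `T`.
  refine (hs.mul_left ((T : ℂ) ^ 2)).of_eq (fun k => ?_) ?_
  · rw [← inner_conj_symm, ← HilbertBasis.repr_apply_apply, ← HilbertBasis.repr_apply_apply,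
      fourierBasis_repr, fourierBasis_repr, fourierCoeff_congr_ae h1.coeFn_toLp,
      fourierCoeff_congr_ae h2.coeFn_toLp, hcoef, hcoef]
    have : conj (∫ x in a..a + T, Complex.exp (-(2 * Real.pi * Complex.I * k * x / T)) * conj (F x)) =
        ∫ x in a..a + T, Complex.exp (2 * Real.pi * Complex.I * k * x / T) * F x := by
      rw [intervalIntegral.integral_of_le (by linarith), intervalIntegral.integral_of_le (by linarith),
        ← integral_conj]
      refine integral_congr_ae (Eventually.of_forall fun x => ?_)
      simp only [map_mul, RCLike.conj_conj, ← Complex.exp_conj]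
      congr 2
      simp only [map_neg, map_div₀, map_mul, Complex.conj_ofReal, Complex.conj_I, map_intCast,
        map_ofNat]
      ring
    simp only [Complex.real_smul, map_mul, Complex.conj_ofReal, this]
    push_cast
    field_simp
  · simp only [Complex.real_smul]
    push_cast
    field_simp

/-- The Poisson-type identity for the pair `F`, `G` and the frequency `lam`. -/
def HasPoisson (lam : ℝ) (F G : ℝ → ℂ) : Prop :=
  ∃ v : ℂ, HasSum (fun k : ℤ => (∫ x : ℝ, F x * Complex.exp (Complex.I * k * lam * x)) *
      (∫ x : ℝ, G x * Complex.exp (-(Complex.I * k * lam * x)))) (2 * Real.pi / |lam| * v) ∧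
    HasSum (fun m : ℤ => ∫ x : ℝ, F x * G (x + 2 * Real.pi * m / lam)) v

lemma HasPoisson.of_neg {lam : ℝ} {F G : ℝ → ℂ} (h : HasPoisson (-lam) F G) :
    HasPoisson lam F G := by
  obtain ⟨v, h1, h2⟩ := h
  refine ⟨v, ?_, ?_⟩
  · rw [← (Equiv.neg ℤ).hasSum_iff, abs_neg] at h1
    refine h1.of_eq (fun k => ?_) rfl
    simp only [Function.comp, Equiv.neg_apply]
    push_cast
    simp only [mul_neg, neg_mul, neg_neg]
  · rw [← (Equiv.neg ℤ).hasSum_iff] at h2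
    refine h2.of_eq (fun m => ?_) rfl
    simp only [Function.comp, Equiv.neg_apply]
    push_cast
    simp only [mul_neg, neg_div_neg_eq]

lemma integrable_mul_exp {F : ℝ → ℂ} (hF : Integrable F) (y : ℝ) :
    Integrable fun x : ℝ => F x * Complex.exp (Complex.I * y * x) := by
  refine hF.mul_bdd (c := 1) (by fun_prop) (Eventually.of_forall fun x => ?_)
  rw [Complex.norm_exp]; simp

lemma _root_.MeasureTheory.MemLp.integrable_mul_add {F G : ℝ → ℂ} (hF : MemLp F 2 volume)
    (hG : MemLp G 2 volume) (c : ℝ) : Integrable fun x : ℝ => F x * G (x + c) :=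
  hF.integrable_mul (hG.comp_measurePreserving (measurePreserving_add_right volume c))

lemma HasPoisson.zero_left (lam : ℝ) (G : ℝ → ℂ) : HasPoisson lam (fun _ => 0) G :=
  ⟨0, by simp [hasSum_zero], by simp [hasSum_zero]⟩

lemma HasPoisson.zero_right (lam : ℝ) (F : ℝ → ℂ) : HasPoisson lam F (fun _ => 0) :=
  ⟨0, by simp [hasSum_zero], by simp [hasSum_zero]⟩

lemma HasPoisson.add_left {lam : ℝ} {F₁ F₂ G : ℝ → ℂ} (h₁ : HasPoisson lam F₁ G)
    (h₂ : HasPoisson lam F₂ G) (i₁ : Integrable F₁) (i₂ : Integrable F₂)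
    (m₁ : MemLp F₁ 2 volume) (m₂ : MemLp F₂ 2 volume) (m : MemLp G 2 volume) :
    HasPoisson lam (fun x => F₁ x + F₂ x) G := by
  obtain ⟨v₁, a₁, b₁⟩ := h₁
  obtain ⟨v₂, a₂, b₂⟩ := h₂
  refine ⟨v₁ + v₂, ?_, ?_⟩
  · refine (a₁.add a₂).of_eq (fun k => ?_) ?_
    · rw [← add_mul, ← integral_add]
      · simp only [add_mul]
      · simpa [mul_assoc] using integrable_mul_exp i₁ (k * lam)
      · simpa [mul_assoc] using integrable_mul_exp i₂ (k * lam)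
    · ring
  · refine (b₁.add b₂).of_eq (fun k => ?_) rfl
    rw [← integral_add (m₁.integrable_mul_add m _) (m₂.integrable_mul_add m _)]
    simp only [add_mul]

lemma HasPoisson.add_right {lam : ℝ} {F G₁ G₂ : ℝ → ℂ} (h₁ : HasPoisson lam F G₁)
    (h₂ : HasPoisson lam F G₂) (i₁ : Integrable G₁) (i₂ : Integrable G₂)
    (m₁ : MemLp G₁ 2 volume) (m₂ : MemLp G₂ 2 volume) (m : MemLp F 2 volume) :
    HasPoisson lam F (fun x => G₁ x + G₂ x) := by
  obtain ⟨v₁, a₁, b₁⟩ := h₁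
  obtain ⟨v₂, a₂, b₂⟩ := h₂
  refine ⟨v₁ + v₂, ?_, ?_⟩
  · refine (a₁.add a₂).of_eq (fun k => ?_) ?_
    · rw [← mul_add, ← integral_add]
      · simp only [add_mul]
      · simpa [mul_assoc] using integrable_mul_exp i₁ (-(k * lam))
      · simpa [mul_assoc] using integrable_mul_exp i₂ (-(k * lam))
    · ring
  · refine (b₁.add b₂).of_eq (fun k => ?_) rfl
    rw [← integral_add (m.integrable_mul_add m₁ _) (m.integrable_mul_add m₂ _)]
    simp only [mul_add]

/-- The cell of index `m` in the tiling of the line by half-open intervals of length `T`. -/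
def cell (T : ℝ) (m : ℤ) : Set ℝ := Set.Ioc (m * T) (m * T + T)

lemma mem_cell_iff {T : ℝ} (hT : 0 < T) {m : ℤ} {x : ℝ} : x ∈ cell T m ↔ m = ⌈x / T⌉ - 1 := by
  rw [cell, Set.mem_Ioc, eq_comm, sub_eq_iff_eq_add, Int.ceil_eq_iff, lt_div_iff₀ hT,
    div_le_iff₀ hT]
  push_cast
  constructor <;> rintro ⟨h1, h2⟩ <;> constructor <;> linarith

lemma add_mem_cell_iff {T : ℝ} {m p : ℤ} {x : ℝ} :
    x + p * T ∈ cell T m ↔ x ∈ cell T (m - p) := by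
  simp only [cell, Set.mem_Ioc]
  push_cast
  constructor <;> rintro ⟨h1, h2⟩ <;> constructor <;> linarith

/-- Translating `G` into the cell of `F` reduces the claim to Parseval: the shift is a multiple of
the period `2π/lam`, so the exponentials do not change. On the other side only the translate by `n -
m` overlaps `F`. -/
lemma hasPoisson_cell {lam : ℝ} (hlam : 0 < lam) {F G : ℝ → ℂ} (hF : MemLp F 2 volume)
    (hG : MemLp G 2 volume) {m n : ℤ} (hFm : ∀ x, x ∉ cell (2 * Real.pi / lam) m → F x = 0)
    (hGn : ∀ x, x ∉ cell (2 * Real.pi / lam) n → G x = 0) : HasPoisson lam F G := by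
  set T := 2 * Real.pi / lam with hTdef
  have hT : 0 < T := by positivity
  have hshift : ∀ p : ℤ, 2 * Real.pi * p / lam = p * T := fun p => by rw [hTdef]; ring
  have hG' : MemLp (fun x => G (x + (n - m : ℤ) * T)) 2 volume :=
    hG.comp_measurePreserving (measurePreserving_add_right volume _)
  have hG'm : ∀ x, x ∉ cell T m → G (x + (n - m : ℤ) * T) = 0 := fun x hx =>
    hGn _ fun h => hx (by simpa using add_mem_cell_iff.1 h)
  have hint : ∀ H : ℝ → ℂ, (∀ x, x ∉ cell T m → H x = 0) →
      ∫ x in (m * T)..(m * T + T), H x = ∫ x, H x := fun H hH => by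
    rw [intervalIntegral.integral_of_le (by linarith)]
    exact setIntegral_eq_integral_of_forall_compl_eq_zero hH
  have hp := hasSum_parseval hT (m * T) (hF.restrict _) (hG'.restrict _)
  refine ⟨∫ x, F x * G (x + (n - m : ℤ) * T), ?_, ?_⟩
  · refine hp.of_eq (fun k => ?_) ?_
    · rw [hint _ fun x hx => by rw [hFm x hx, mul_zero],
        hint _ fun x hx => by rw [hG'm x hx, mul_zero],
        ← integral_add_right_eq_self (fun x => G x * _) ((n - m : ℤ) * T)]
      have hl : (lam : ℂ) ≠ 0 := Complex.ofReal_ne_zero.2 hlam.ne'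
      have hπ : (Real.pi : ℂ) ≠ 0 := Complex.ofReal_ne_zero.2 Real.pi_ne_zero
      congr 1
      · refine integral_congr_ae (Eventually.of_forall fun x => ?_)
        simp only
        rw [mul_comm, hTdef]
        congr 2
        push_cast
        field_simp
      · refine integral_congr_ae (Eventually.of_forall fun x => ?_)
        simp only
        rw [mul_comm]
        congr 1
        rw [Complex.exp_eq_exp_iff_exists_int]
        refine ⟨-(k * (n - m)), ?_⟩
        rw [hTdef]
        push_cast
        field_simp
        ring
    · rw [hint _ fun x hx => by rw [hFm x hx, zero_mul], abs_of_pos hlam, hTdef]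
      push_cast
      rfl
  · simp only [hshift]
    refine hasSum_single (n - m) fun p hp => ?_
    convert integral_zero ℝ ℂ with x
    by_cases hx : x ∈ cell T m
    · rw [hGn _ fun h => hp ?_, mul_zero]
      rw [add_mem_cell_iff, mem_cell_iff hT] at h
      rw [mem_cell_iff hT] at hx
      omega
    · rw [hFm x hx, zero_mul]

lemma exists_eq_sum_indicator_cell {T : ℝ} (hT : 0 < T) {F : ℝ → ℂ} {R : ℝ}
    (hF : ∀ x, R < |x| → F x = 0) :
    ∃ s : Finset ℤ, F = fun x => ∑ m ∈ s, (cell T m).indicator F x := by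
  refine ⟨Finset.Icc (⌈-R / T⌉ - 1) (⌈R / T⌉ - 1), funext fun x => ?_⟩
  by_cases hx : F x = 0
  · rw [hx]
    exact (Finset.sum_eq_zero fun m _ => Set.indicator_apply_eq_zero.2 fun _ => hx).symm
  · have hxR : |x| ≤ R := not_lt.1 fun h => hx (hF x h)
    rw [abs_le] at hxR
    rw [Finset.sum_eq_single (⌈x / T⌉ - 1)]
    · rw [Set.indicator_of_mem ((mem_cell_iff hT).2 rfl)]
    · intro m _ hm
      exact Set.indicator_of_notMem (fun h => hm ((mem_cell_iff hT).1 h)) _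
    · intro h
      refine absurd (Finset.mem_Icc.2 ⟨?_, ?_⟩) h
      · have : -R / T ≤ x / T := by gcongr; exact hxR.1
        have := Int.ceil_le_ceil this
        omega
      · have : x / T ≤ R / T := by gcongr; exact hxR.2
        have := Int.ceil_le_ceil this
        omega

lemma HasPoisson.sum_left {lam : ℝ} {G : ℝ → ℂ} (s : Finset ℤ) {F : ℤ → ℝ → ℂ}
    (h : ∀ m, HasPoisson lam (F m) G) (i : ∀ m, Integrable (F m)) (hF : ∀ m, MemLp (F m) 2 volume)
    (hG : MemLp G 2 volume) : HasPoisson lam (fun x => ∑ m ∈ s, F m x) G := by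
  classical
  induction s using Finset.induction_on with
  | empty => simpa using HasPoisson.zero_left lam G
  | insert m s hm ih =>
    simp only [Finset.sum_insert hm]
    exact (h m).add_left ih (i m) (integrable_finsetSum s fun m _ => i m) (hF m)
      (memLp_finsetSum s fun m _ => hF m) hG

lemma HasPoisson.sum_right {lam : ℝ} {F : ℝ → ℂ} (s : Finset ℤ) {G : ℤ → ℝ → ℂ}
    (h : ∀ m, HasPoisson lam F (G m)) (i : ∀ m, Integrable (G m)) (hG : ∀ m, MemLp (G m) 2 volume)
    (hF : MemLp F 2 volume) : HasPoisson lam F (fun x => ∑ m ∈ s, G m x) := by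
  classical
  induction s using Finset.induction_on with
  | empty => simpa using HasPoisson.zero_right lam F
  | insert m s hm ih =>
    simp only [Finset.sum_insert hm]
    exact (h m).add_right ih (i m) (integrable_finsetSum s fun m _ => i m) (hG m)
      (memLp_finsetSum s fun m _ => hG m) hF

/-- Compact support leaves finitely many cells, and the identity is bilinear, so no convergence
question arises beyond Parseval. -/
theorem hasPoisson_of_memLp {lam : ℝ} (hlam : lam ≠ 0) {F G : ℝ → ℂ} (hF : MemLp F 2 volume)
    (hG : MemLp G 2 volume) (iF : Integrable F) (iG : Integrable G) {R : ℝ}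
    (sF : ∀ x, R < |x| → F x = 0) (sG : ∀ x, R < |x| → G x = 0) : HasPoisson lam F G := by
  wlog hpos : 0 < lam generalizing lam
  · exact (this (neg_ne_zero.2 hlam) (by
      rcases lt_or_gt_of_ne hlam with h | h
      · linarith
      · exact absurd h hpos)).of_neg
  have hT : 0 < 2 * Real.pi / lam := by positivity
  have hms : ∀ m, MeasurableSet (cell (2 * Real.pi / lam) m) := fun m => measurableSet_Ioc
  obtain ⟨s, hs⟩ := exists_eq_sum_indicator_cell hT sF
  obtain ⟨t, ht⟩ := exists_eq_sum_indicator_cell hT sG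
  rw [hs]
  refine HasPoisson.sum_left s (fun m => ?_) (fun m => iF.indicator (hms m))
    (fun m => hF.indicator (hms m)) hG
  rw [ht]
  refine HasPoisson.sum_right t (fun n => ?_) (fun m => iG.indicator (hms m))
    (fun m => hG.indicator (hms m)) (hF.indicator (hms m))
  exact hasPoisson_cell hpos (hF.indicator (hms m)) (hG.indicator (hms n))
    (fun x hx => Set.indicator_of_notMem hx _) (fun x hx => Set.indicator_of_notMem hx _)

/-! ### Local `L_p` classes and the spectral form of frame sums. -/

lemma memLpLoc_of_continuous {f : ℝ → ℂ} (hf : Continuous f) (p : ℝ≥0∞) : MemLpLoc p f := by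
  intro K hK
  have := Fact.mk (hK.measure_lt_top (μ := (volume : Measure ℝ)))
  obtain ⟨C, hC⟩ := hK.exists_bound_of_continuousOn hf.continuousOn
  refine MemLp.of_bound hf.aestronglyMeasurable C ?_
  filter_upwards [ae_restrict_mem hK.measurableSet] with x hx using hC x hx

namespace MemLpLoc

variable {p : ℝ≥0∞} {f g : ℝ → ℂ}

lemma mul_continuous (hf : MemLpLoc p f) (hg : Continuous g) : MemLpLoc p fun x => f x * g x := by
  intro K hK
  obtain ⟨C, hC⟩ := hK.exists_bound_of_continuousOn hg.continuousOn
  refine ((hf K hK).norm.const_mul C).of_le ((hf K hK).1.mul hg.aestronglyMeasurable) ?_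
  filter_upwards [ae_restrict_mem hK.measurableSet] with x hx
  rw [norm_mul, norm_mul, norm_norm, mul_comm]
  exact mul_le_mul_of_nonneg_right ((hC x hx).trans (le_abs_self C)) (norm_nonneg _)

lemma comp_mul (hf : MemLpLoc p f) {c : ℝ} (hc : c ≠ 0) : MemLpLoc p fun x => f (c * x) := by
  intro K hK
  have hK' : IsCompact ((fun x => c * x) '' K) := hK.image (by fun_prop)
  have hmeas : Measurable fun x : ℝ => c * x := by fun_prop
  have hmap : (volume.restrict K).map (fun x => c * x) =
      ENNReal.ofReal |c⁻¹| • volume.restrict ((fun x => c * x) '' K) := by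
    rw [← Measure.restrict_smul, ← Real.map_volume_mul_left hc,
      Measure.restrict_map hmeas hK'.measurableSet,
      Set.preimage_image_eq K (mul_right_injective₀ hc)]
  have h1 : MemLp f p ((volume.restrict K).map fun x => c * x) := by
    rw [hmap]
    exact (hf _ hK').smul_measure ENNReal.ofReal_ne_top
  exact h1.comp_of_map hmeas.aemeasurable

lemma comp_add (hf : MemLpLoc p f) (c : ℝ) : MemLpLoc p fun x => f (x + c) := by
  intro K hK
  have hK' : IsCompact ((fun x => x + c) '' K) := hK.image (by fun_prop)
  have hmeas : Measurable fun x : ℝ => x + c := by fun_prop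
  have h1 : MemLp f p ((volume.restrict K).map fun x => x + c) := by
    have := Measure.restrict_map hmeas hK'.measurableSet (μ := volume)
    rw [Set.preimage_image_eq K (add_left_injective c), map_add_right_eq_self] at this
    rw [← this]
    exact hf _ hK'
  exact h1.comp_of_map hmeas.aemeasurable

lemma star (hf : MemLpLoc p f) : MemLpLoc p fun x => conj (f x) := fun K hK => (hf K hK).star

lemma locallyIntegrable_mul (hf : MemLpLoc 2 f) (hg : MemLpLoc 2 g) :
    LocallyIntegrable (fun x => f x * g x) volume :=
  locallyIntegrable_iff.2 fun K hK => (hf K hK).integrable_mul (hg K hK)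

lemma locallyIntegrable (hf : MemLpLoc 2 f) : LocallyIntegrable f volume := by
  simpa using hf.locallyIntegrable_mul (memLpLoc_of_continuous (continuous_const (y := (1 : ℂ))) 2)

lemma memLp_testFun_mul (hf : MemLpLoc p f) (u : TestFun) : MemLp (fun x => u x * f x) p volume := by
  have hK : IsCompact (tsupport u) := u.hasCompactSupport
  have h1 := (hf.mul_continuous u.continuous) _ hK
  rw [← memLp_indicator_iff_restrict hK.measurableSet] at h1
  refine h1.ae_eq (Eventually.of_forall fun x => ?_)
  by_cases hx : x ∈ tsupport u
  · rw [Set.indicator_of_mem hx, mul_comm]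
  · simp [hx, image_eq_zero_of_notMem_tsupport hx]

lemma integrable_testFun_mul (hf : MemLpLoc 2 f) (u : TestFun) :
    Integrable (fun x => u x * f x) volume := by
  simpa [mul_comm] using hf.locallyIntegrable.integrable_mul_testFun u

end MemLpLoc

/-- The complex conjugate of a test function. -/
def conjTest (f : TestFun) : TestFun :=
  mkTest (fun x => conj (f x)) (Complex.conjCLE.contDiff.comp f.contDiff)
    (f.hasCompactSupport.comp_left (map_zero _))

@[simp] lemma conjTest_apply (f : TestFun) (x : ℝ) : conjTest f x = conj (f x) := rfl

lemma exists_bound_support (f : TestFun) : ∃ R, ∀ x, R < |x| → f x = 0 := by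
  obtain ⟨R, hR⟩ := f.hasCompactSupport.isBounded.exists_norm_le
  exact ⟨R, fun x hx => image_eq_zero_of_notMem_tsupport fun h => hx.not_ge (hR x h)⟩

lemma frameTerm_eq (lam : ℝ) (φ φ' : ℝ → ℂ) (f g : TestFun) (k : ℤ) :
    frameTerm lam φ φ' f g k = |lam| *
      ((∫ x : ℝ, (f x * conj (φ (lam * x))) * Complex.exp (Complex.I * k * lam * x)) *
      (∫ x : ℝ, (conjTest g x * φ' (lam * x)) * Complex.exp (-(Complex.I * k * lam * x)))) := by
  have h1 : pair f (tdm φ lam 0 k) = (Real.sqrt |lam| : ℂ) *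
      ∫ x : ℝ, (f x * conj (φ (lam * x))) * Complex.exp (Complex.I * k * lam * x) := by
    rw [pair, ← integral_const_mul]
    refine integral_congr_ae (Eventually.of_forall fun x => ?_)
    simp only [tdm, map_mul, ← Complex.exp_conj, Complex.conj_ofReal, map_neg, Complex.conj_I,
      sub_zero, neg_mul, neg_neg, Complex.ofReal_intCast, map_intCast]
    ring
  have h2 : pair (tdm φ' lam 0 k) g = (Real.sqrt |lam| : ℂ) *
      ∫ x : ℝ, (conjTest g x * φ' (lam * x)) * Complex.exp (-(Complex.I * k * lam * x)) := by
    rw [pair, ← integral_const_mul]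
    refine integral_congr_ae (Eventually.of_forall fun x => ?_)
    simp only [tdm, conjTest_apply, sub_zero, Complex.ofReal_intCast]
    ring
  rw [frameTerm, h1, h2, mul_mul_mul_comm, ← Complex.ofReal_mul,
    Real.mul_self_sqrt (abs_nonneg lam)]

/-- The integrand of the `m`-th term of the spectral form of the frame sums. -/
def frameKernel (lam : ℝ) (φ φ' : ℝ → ℂ) (f g : TestFun) (m : ℤ) (x : ℝ) : ℂ :=
  (f x * conj (φ (lam * x))) *
    (conjTest g (x + 2 * Real.pi * m / lam) * φ' (lam * (x + 2 * Real.pi * m / lam)))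

lemma integrable_frameKernel {lam : ℝ} (hlam : lam ≠ 0) {φ φ' : ℝ → ℂ} (hφ : MemLpLoc 2 φ)
    (hφ' : MemLpLoc 2 φ') (f g : TestFun) (m : ℤ) :
    Integrable (frameKernel lam φ φ' f g m) volume :=
  ((hφ.comp_mul hlam).star.memLp_testFun_mul f).integrable_mul_add
    ((hφ'.comp_mul hlam).memLp_testFun_mul (conjTest g)) _

/-- The two normalisations `|lam|^{1/2}` cancel the factor `1/|lam|` of the Poisson identity, so the
constant `2π` is the same at all scales. -/
theorem hasSum_frameTerm {lam : ℝ} (hlam : lam ≠ 0) {φ φ' : ℝ → ℂ} (hφ : MemLpLoc 2 φ)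
    (hφ' : MemLpLoc 2 φ') (f g : TestFun) :
    ∃ v : ℂ, HasSum (frameTerm lam φ φ' f g) (2 * Real.pi * v) ∧
      HasSum (fun m : ℤ => ∫ x, frameKernel lam φ φ' f g m x) v := by
  obtain ⟨R₁, h₁⟩ := exists_bound_support f
  obtain ⟨R₂, h₂⟩ := exists_bound_support g
  obtain ⟨v, hv, hv'⟩ := hasPoisson_of_memLp hlam ((hφ.comp_mul hlam).star.memLp_testFun_mul f)
    ((hφ'.comp_mul hlam).memLp_testFun_mul (conjTest g))
    ((hφ.comp_mul hlam).star.integrable_testFun_mul f)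
    ((hφ'.comp_mul hlam).integrable_testFun_mul (conjTest g)) (R := max R₁ R₂)
    (fun x hx => by rw [h₁ x ((le_max_left _ _).trans_lt hx), zero_mul])
    (fun x hx => by rw [conjTest_apply, h₂ x ((le_max_right _ _).trans_lt hx), map_zero, zero_mul])
  refine ⟨v, (hv.mul_left ((|lam| : ℝ) : ℂ)).of_eq (frameTerm_eq lam φ φ' f g) ?_, hv'⟩
  have : ((|lam| : ℝ) : ℂ) ≠ 0 := Complex.ofReal_ne_zero.2 (abs_pos.2 hlam).ne'
  field_simp

/-- `HasSum` over `ℤ` is unconditional, which in `ℂ` means absolute convergence. -/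
theorem summable_norm_frameTerm {lam : ℝ} (hlam : lam ≠ 0) {φ φ' : ℝ → ℂ} (hφ : MemLpLoc 2 φ)
    (hφ' : MemLpLoc 2 φ') (f g : TestFun) : Summable fun k => ‖frameTerm lam φ φ' f g k‖ :=
  (hasSum_frameTerm hlam hφ hφ' f g).choose_spec.1.summable.norm

/-- The sum of the frame terms over a finite family of pairs of generators. -/
def frameSum (lam : ℝ) {r : ℕ} (φ φ' : Fin r → ℝ → ℂ) (f g : TestFun) : ℂ :=
  ∑ l, ∑' k : ℤ, frameTerm lam (φ l) (φ' l) f g k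

theorem hasSum_frameKernel {lam : ℝ} (hlam : lam ≠ 0) {r : ℕ} {φ φ' : Fin r → ℝ → ℂ}
    (hφ : ∀ l, MemLpLoc 2 (φ l)) (hφ' : ∀ l, MemLpLoc 2 (φ' l)) (f g : TestFun) :
    HasSum (fun m : ℤ => ∫ x, ∑ l, frameKernel lam (φ l) (φ' l) f g m x)
      (frameSum lam φ φ' f g / (2 * Real.pi)) := by
  choose v hv hv' using fun l => hasSum_frameTerm hlam (hφ l) (hφ' l) f g
  refine (hasSum_sum fun l (_ : l ∈ Finset.univ) => hv' l).of_eq (fun m => ?_) ?_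
  · exact integral_finsetSum _ fun l _ => integrable_frameKernel hlam (hφ l) (hφ' l) f g m
  · have hπ : (Real.pi : ℂ) ≠ 0 := Complex.ofReal_ne_zero.2 Real.pi_ne_zero
    simp only [frameSum, (hv _).tsum_eq, ← Finset.mul_sum]
    field_simp

/-! ### One step of the cascade and its defect. -/

/-- The masks and filters of a nonstationary oblique extension principle. -/
structure OEPData where
  /-- The dilation factors. -/
  d : ℕ → ℤ
  /-- The refinement masks. -/
  a : ℕ → TrigPoly
  /-- The dual refinement masks. -/
  a' : ℕ → TrigPoly
  /-- The number of filters `θ j`. -/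
  r : ℕ → ℕ
  /-- The number of filters `b j`. -/
  s : ℕ → ℕ
  /-- The moment correcting filters. -/
  θ : ∀ j, Fin (r j) → ℝ → ℂ
  /-- The dual moment correcting filters. -/
  θ' : ∀ j, Fin (r j) → ℝ → ℂ
  /-- The wavelet masks. -/
  b : ∀ j, Fin (s j) → ℝ → ℂ
  /-- The dual wavelet masks. -/
  b' : ∀ j, Fin (s j) → ℝ → ℂ
  d_ne : ∀ j, d j ≠ 0
  tendsto_prod : Tendsto (fun j => ∏ n ∈ Finset.range j, |d n|) atTop atTop
  mask : IsMaskSeq d a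
  mask' : IsMaskSeq d a'
  filter_θ : IsFilterFamily θ
  filter_θ' : IsFilterFamily θ'
  filter_b : IsFilterFamily b
  filter_b' : IsFilterFamily b'

lemma memLpLoc_genPhi {d : ℕ → ℤ} {a : ℕ → TrigPoly} (ha : IsMaskSeq d a) {r : ℕ → ℕ}
    {θ : ∀ j, Fin (r j) → ℝ → ℂ} (hθ : IsFilterFamily θ) (j : ℕ) (l : Fin (r j)) :
    MemLpLoc 2 (genPhi d a θ j l) :=
  (hθ j l).2.mul_continuous (ha.continuous_refFun j)

lemma memLpLoc_genPsi {d : ℕ → ℤ} (hd : ∀ j, d j ≠ 0) {a : ℕ → TrigPoly} (ha : IsMaskSeq d a)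
    {s : ℕ → ℕ} {b : ∀ j, Fin (s j) → ℝ → ℂ} (hb : IsFilterFamily b) (j : ℕ) (l : Fin (s j)) :
    MemLpLoc 2 (genPsi d a b j l) := by
  have h := ((hb j l).2.mul_continuous (ha.continuous_refFun (j + 1))).comp_mul
    (inv_ne_zero (Int.cast_ne_zero.2 (hd j) : (d j : ℝ) ≠ 0))
  simp only [inv_mul_eq_div] at h
  exact h

lemma genPhi_scale_mul {d : ℕ → ℤ} (hd : ∀ j, d j ≠ 0) (a : ℕ → TrigPoly) {r : ℕ → ℕ}
    (θ : ∀ j, Fin (r j) → ℝ → ℂ) (j : ℕ) (l : Fin (r j)) (x : ℝ) :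
    genPhi d a θ j l (scale d j * x) = θ j l (scale d j * x) * tailProd d a j x := by
  rw [genPhi, refFun_scale_mul hd]

lemma genPsi_scale_mul {d : ℕ → ℤ} (hd : ∀ j, d j ≠ 0) (a : ℕ → TrigPoly) {s : ℕ → ℕ}
    (b : ∀ j, Fin (s j) → ℝ → ℂ) (j : ℕ) (l : Fin (s j)) (x : ℝ) :
    genPsi d a b j l (scale d j * x) =
      b j l (scale d (j + 1) * x) * tailProd d a (j + 1) x := by
  have h : scale d j * x / d j = scale d (j + 1) * x := by
    have : (d j : ℝ) ≠ 0 := Int.cast_ne_zero.2 (hd j)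
    rw [← scale_succ_mul hd]; field_simp
  rw [genPsi, h, refFun_scale_mul hd]

lemma periodic_add_int {f : ℝ → ℂ} (hf : Function.Periodic f (2 * Real.pi)) (x : ℝ) (m : ℤ) :
    f (x + 2 * Real.pi * m) = f x := by
  rw [mul_comm]; exact hf.int_mul m x

namespace OEPData

variable (D : OEPData)

/-- The scale of level `j`. -/
abbrev lam (j : ℕ) : ℝ := scale D.d j

/-- The function `Θ^j`. -/
abbrev Th (j : ℕ) : ℝ → ℂ := bigTheta D.θ D.θ' j

/-- The frame sum of the level `j` generators `φ^{j,l}`. -/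
def sumPhi (j : ℕ) (f g : TestFun) : ℂ :=
  frameSum (D.lam j) (genPhi D.d D.a D.θ j) (genPhi D.d D.a' D.θ' j) f g

/-- The frame sum of the level `j` generators `ψ^{j,l}`. -/
def sumPsi (j : ℕ) (f g : TestFun) : ℂ :=
  frameSum (D.lam j) (genPsi D.d D.a D.b j) (genPsi D.d D.a' D.b' j) f g

/-- The kernel `conj (φ^j(λ_j x)) φ'^j(λ_j (x + c))`. -/
def tailKernel (j : ℕ) (c x : ℝ) : ℂ :=
  conj (tailProd D.d D.a j x) * tailProd D.d D.a' j ((x + c : ℝ) : ℂ)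

/-- The difference of the two sides of the perfect reconstruction equations. -/
def defect (j : ℕ) (m : ℤ) (η : ℝ) : ℂ :=
  D.Th j (D.d j * η) * conj ((D.a j).eval η) * (D.a' j).eval (η + 2 * Real.pi * m / D.d j) +
    ∑ l, conj (D.b j l η) * D.b' j l (η + 2 * Real.pi * m / D.d j) -
      if D.d j ∣ m then D.Th (j + 1) η else 0

lemma lam_ne (j : ℕ) : D.lam j ≠ 0 := scale_ne_zero D.d_ne j

/-- The shift `2πm/λ_j` becomes `2πm` inside the periodic filter and disappears, so the filters
combine into `Θ^j`. -/
lemma sum_frameKernel_phi (j : ℕ) (f g : TestFun) (m : ℤ) (x : ℝ) :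
    ∑ l, frameKernel (D.lam j) (genPhi D.d D.a D.θ j l) (genPhi D.d D.a' D.θ' j l) f g m x =
      f x * (conj (g (x + 2 * Real.pi * m / D.lam j)) *
        (D.tailKernel j (2 * Real.pi * m / D.lam j) x * D.Th j (D.lam j * x))) := by
  have hl := D.lam_ne j
  simp only [frameKernel, Th, bigTheta, Finset.mul_sum, conjTest_apply]
  refine Finset.sum_congr rfl fun l _ => ?_
  have hper : D.θ' j l (D.lam j * (x + 2 * Real.pi * m / D.lam j)) = D.θ' j l (D.lam j * x) := by
    rw [mul_add, mul_div_cancel₀ _ hl]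
    exact periodic_add_int (D.filter_θ' j l).1 _ m
  rw [genPhi_scale_mul D.d_ne, genPhi_scale_mul D.d_ne, hper, tailKernel, map_mul]
  ring

/-- Here the masks live at scale `λ_{j+1}`, where the same shift becomes `2πm/d_j` and remains
visible. -/
lemma sum_frameKernel_psi (j : ℕ) (f g : TestFun) (m : ℤ) (x : ℝ) :
    ∑ l, frameKernel (D.lam j) (genPsi D.d D.a D.b j l) (genPsi D.d D.a' D.b' j l) f g m x =
      f x * (conj (g (x + 2 * Real.pi * m / D.lam j)) *
        (D.tailKernel (j + 1) (2 * Real.pi * m / D.lam j) x *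
        ∑ l, conj (D.b j l (D.lam (j + 1) * x)) *
          D.b' j l (D.lam (j + 1) * x + 2 * Real.pi * m / D.d j))) := by
  have hl := D.lam_ne (j + 1)
  have hd : (D.d j : ℝ) ≠ 0 := Int.cast_ne_zero.2 (D.d_ne j)
  simp only [frameKernel, Finset.mul_sum, conjTest_apply]
  refine Finset.sum_congr rfl fun l _ => ?_
  have hper : D.lam (j + 1) * (x + 2 * Real.pi * m / D.lam j) =
      D.lam (j + 1) * x + 2 * Real.pi * m / D.d j := by
    rw [mul_add, show D.lam j = D.lam (j + 1) * D.d j from (scale_succ_mul D.d_ne j).symm]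
    field_simp
  rw [genPsi_scale_mul D.d_ne, genPsi_scale_mul D.d_ne, hper, tailKernel, map_mul]
  ring

lemma tailKernel_succ (j : ℕ) (m : ℤ) (x : ℝ) :
    D.tailKernel j (2 * Real.pi * m / D.lam j) x =
      conj ((D.a j).eval (D.lam (j + 1) * x)) *
        (D.a' j).eval (D.lam (j + 1) * x + 2 * Real.pi * m / D.d j) *
        D.tailKernel (j + 1) (2 * Real.pi * m / D.lam j) x := by
  have hl := D.lam_ne (j + 1)
  have hd : (D.d j : ℝ) ≠ 0 := Int.cast_ne_zero.2 (D.d_ne j)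
  have hper : D.lam (j + 1) * (x + 2 * Real.pi * m / D.lam j) =
      D.lam (j + 1) * x + 2 * Real.pi * m / D.d j := by
    rw [mul_add, show D.lam j = D.lam (j + 1) * D.d j from (scale_succ_mul D.d_ne j).symm]
    field_simp
  rw [tailKernel, D.mask.tailProd_succ, D.mask'.tailProd_succ, ← Complex.ofReal_mul,
    ← Complex.ofReal_mul, hper, TrigPoly.evalC_ofReal, TrigPoly.evalC_ofReal, map_mul, tailKernel]
  ring

/-- The integrand of the `m`-th term of `sumPhi j + sumPsi j - sumPhi (j + 1)`. -/
def defectKernel (j : ℕ) (f g : TestFun) (m : ℤ) (x : ℝ) : ℂ :=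
  f x * (conj (g (x + 2 * Real.pi * m / D.lam j)) *
    (D.tailKernel (j + 1) (2 * Real.pi * m / D.lam j) x * D.defect j m (D.lam (j + 1) * x)))

lemma shift_succ (j : ℕ) (n : ℤ) :
    2 * Real.pi * ((n * D.d j : ℤ) : ℝ) / D.lam j = 2 * Real.pi * n / D.lam (j + 1) := by
  have hl := D.lam_ne (j + 1)
  have hd : (D.d j : ℝ) ≠ 0 := Int.cast_ne_zero.2 (D.d_ne j)
  rw [show D.lam j = D.lam (j + 1) * D.d j from (scale_succ_mul D.d_ne j).symm]
  push_cast
  field_simp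

/-- The shifts `2πn/λ_{j+1}` of the next level are the shifts `2πm/λ_j` with `m = n d_j`; hence the
divisibility condition. The refinement equation moves the kernel of level `j` to level `j + 1`,
which can then be factored out. -/
lemma defectKernel_eq (j : ℕ) (f g : TestFun) (m : ℤ) (x : ℝ) :
    D.defectKernel j f g m x =
      ∑ l, frameKernel (D.lam j) (genPhi D.d D.a D.θ j l) (genPhi D.d D.a' D.θ' j l) f g m x +
      ∑ l, frameKernel (D.lam j) (genPsi D.d D.a D.b j l) (genPsi D.d D.a' D.b' j l) f g m x -
      if D.d j ∣ m then ∑ l, frameKernel (D.lam (j + 1)) (genPhi D.d D.a D.θ (j + 1) l)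
        (genPhi D.d D.a' D.θ' (j + 1) l) f g (m / D.d j) x else 0 := by
  have hdl : D.lam j * x = D.d j * (D.lam (j + 1) * x) := by
    rw [show D.lam j = D.lam (j + 1) * D.d j from (scale_succ_mul D.d_ne j).symm]; ring
  rw [sum_frameKernel_phi, sum_frameKernel_psi, sum_frameKernel_phi, tailKernel_succ, hdl,
    defectKernel, defect]
  split_ifs with h
  · rw [← D.shift_succ, Int.ediv_mul_cancel h]
    ring
  · ring

lemma memLpLoc_phi (j : ℕ) (l : Fin (D.r j)) : MemLpLoc 2 (genPhi D.d D.a D.θ j l) :=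
  memLpLoc_genPhi D.mask D.filter_θ j l

lemma memLpLoc_phi' (j : ℕ) (l : Fin (D.r j)) : MemLpLoc 2 (genPhi D.d D.a' D.θ' j l) :=
  memLpLoc_genPhi D.mask' D.filter_θ' j l

lemma memLpLoc_psi (j : ℕ) (l : Fin (D.s j)) : MemLpLoc 2 (genPsi D.d D.a D.b j l) :=
  memLpLoc_genPsi D.d_ne D.mask D.filter_b j l

lemma memLpLoc_psi' (j : ℕ) (l : Fin (D.s j)) : MemLpLoc 2 (genPsi D.d D.a' D.b' j l) :=
  memLpLoc_genPsi D.d_ne D.mask' D.filter_b' j l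

lemma integrable_sum_frameKernel_phi (j : ℕ) (f g : TestFun) (m : ℤ) :
    Integrable (fun x => ∑ l, frameKernel (D.lam j) (genPhi D.d D.a D.θ j l)
      (genPhi D.d D.a' D.θ' j l) f g m x) volume :=
  integrable_finsetSum _ fun l _ =>
    integrable_frameKernel (D.lam_ne j) (D.memLpLoc_phi j l) (D.memLpLoc_phi' j l) f g m

lemma integrable_sum_frameKernel_psi (j : ℕ) (f g : TestFun) (m : ℤ) :
    Integrable (fun x => ∑ l, frameKernel (D.lam j) (genPsi D.d D.a D.b j l)
      (genPsi D.d D.a' D.b' j l) f g m x) volume :=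
  integrable_finsetSum _ fun l _ =>
    integrable_frameKernel (D.lam_ne j) (D.memLpLoc_psi j l) (D.memLpLoc_psi' j l) f g m

theorem hasSum_defectKernel (j : ℕ) (f g : TestFun) :
    HasSum (fun m : ℤ => ∫ x, D.defectKernel j f g m x)
      ((D.sumPhi j f g + D.sumPsi j f g - D.sumPhi (j + 1) f g) / (2 * Real.pi)) := by
  have h1 := hasSum_frameKernel (D.lam_ne j) (D.memLpLoc_phi j) (D.memLpLoc_phi' j) f g
  have h2 := hasSum_frameKernel (D.lam_ne j) (D.memLpLoc_psi j) (D.memLpLoc_psi' j) f g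
  have h3 := hasSum_frameKernel (D.lam_ne (j + 1)) (D.memLpLoc_phi (j + 1))
    (D.memLpLoc_phi' (j + 1)) f g
  have h4 : HasSum (fun m : ℤ => ∫ x, if D.d j ∣ m then
      ∑ l, frameKernel (D.lam (j + 1)) (genPhi D.d D.a D.θ (j + 1) l)
        (genPhi D.d D.a' D.θ' (j + 1) l) f g (m / D.d j) x else 0)
      (D.sumPhi (j + 1) f g / (2 * Real.pi)) := by
    -- The sum of level `j + 1` is extended by zero along `n ↦ n * d j`, so that all three sums run
    -- over the same `m`.
    rw [← (mul_left_injective₀ (D.d_ne j)).hasSum_iff]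
    · refine h3.of_eq (fun n => ?_) rfl
      simp [Int.mul_ediv_cancel _ (D.d_ne j)]
    · intro m hm
      have : ¬ D.d j ∣ m := fun ⟨n, hn⟩ => hm ⟨n, by simp [hn, mul_comm]⟩
      simp [this]
  refine ((h1.add h2).sub h4).of_eq (fun m => ?_) ?_
  · rw [← integral_add (D.integrable_sum_frameKernel_phi j f g m)
      (D.integrable_sum_frameKernel_psi j f g m), ← integral_sub]
    · simp only [defectKernel_eq]
    · exact (D.integrable_sum_frameKernel_phi j f g m).add
        (D.integrable_sum_frameKernel_psi j f g m)
    · split_ifs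
      · exact D.integrable_sum_frameKernel_phi (j + 1) f g _
      · exact integrable_zero _ _ _
  · rw [sumPhi, sumPsi, sumPhi]
    ring

end OEPData

/-! ### The one-step identity and the vanishing of the defects. -/

lemma ae_comp_mul_iff {c : ℝ} (hc : c ≠ 0) {p : ℝ → Prop} :
    (∀ᵐ x : ℝ, p (c * x)) ↔ ∀ᵐ x : ℝ, p x := by
  have h1 : MeasurableEmbedding fun x : ℝ => c * x :=
    (Homeomorph.mulLeft₀ c hc).measurableEmbedding
  rw [← h1.ae_map_iff, Real.map_volume_mul_left hc, Measure.ae_ennreal_smul_measure_iff]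
  simpa using hc

namespace MemLpLoc

variable {p : ℝ≥0∞} {f g : ℝ → ℂ}

lemma mul (hf : MemLpLoc 2 f) (hg : MemLpLoc 2 g) : MemLpLoc 1 fun x => f x * g x :=
  fun K hK => memLp_one_iff_integrable.2 ((hf K hK).integrable_mul (hg K hK))

lemma add (hf : MemLpLoc p f) (hg : MemLpLoc p g) : MemLpLoc p fun x => f x + g x :=
  fun K hK => (hf K hK).add (hg K hK)

lemma sub (hf : MemLpLoc p f) (hg : MemLpLoc p g) : MemLpLoc p fun x => f x - g x :=
  fun K hK => (hf K hK).sub (hg K hK)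

lemma finsetSum {ι : Type*} (s : Finset ι) {f : ι → ℝ → ℂ} (hf : ∀ i, MemLpLoc p (f i)) :
    MemLpLoc p fun x => ∑ i ∈ s, f i x :=
  fun K hK => memLp_finsetSum s fun i _ => hf i K hK

lemma locallyIntegrable_of_one (hf : MemLpLoc 1 f) : LocallyIntegrable f volume :=
  locallyIntegrable_iff.2 fun K hK => memLp_one_iff_integrable.1 (hf K hK)

end MemLpLoc

/-- The complex test function given by a real one. -/
def ofRealTest (u : ℝ → ℝ) (hu : ContDiff ℝ (⊤ : ℕ∞) u) (hc : HasCompactSupport u) : TestFun :=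
  mkTest (fun x => (u x : ℂ)) (Complex.ofRealCLM.contDiff.comp hu)
    (hc.comp_left Complex.ofReal_zero)

@[simp] lemma ofRealTest_apply (u : ℝ → ℝ) (hu : ContDiff ℝ (⊤ : ℕ∞) u) (hc : HasCompactSupport u)
    (x : ℝ) : ofRealTest u hu hc x = (u x : ℂ) := rfl

/-- A test function equal to `1` on a given ball. -/
lemma exists_testFun_eq_one (x₀ : ℝ) {ε : ℝ} (hε : 0 < ε) :
    ∃ g : TestFun, (∀ x, |x - x₀| ≤ ε → g x = 1) ∧ ∀ x, 2 * ε ≤ |x - x₀| → g x = 0 := by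
  let B : ContDiffBump x₀ := ⟨ε, 2 * ε, hε, by linarith⟩
  refine ⟨ofRealTest B B.contDiff B.hasCompactSupport, fun x hx => ?_, fun x hx => ?_⟩
  · rw [ofRealTest_apply, B.one_of_mem_closedBall (by simpa [Real.dist_eq] using hx),
      Complex.ofReal_one]
  · rw [ofRealTest_apply, B.zero_of_le_dist (by simpa [Real.dist_eq] using hx), Complex.ofReal_zero]

namespace OEPData

variable (D : OEPData)

lemma memLpLoc_Th (j : ℕ) : MemLpLoc 1 (D.Th j) :=
  MemLpLoc.finsetSum _ fun l => (D.filter_θ j l).2.star.mul (D.filter_θ' j l).2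

lemma memLpLoc_defect (j : ℕ) (m : ℤ) : MemLpLoc 1 (D.defect j m) := by
  have hd : (D.d j : ℝ) ≠ 0 := Int.cast_ne_zero.2 (D.d_ne j)
  have h1 := (((D.memLpLoc_Th j).comp_mul hd).mul_continuous
    (g := fun η => conj ((D.a j).eval η)) (by
      have := (D.a j).continuous_eval; fun_prop)).mul_continuous
    (g := fun η => (D.a' j).eval (η + 2 * Real.pi * m / D.d j)) (by
      have := (D.a' j).continuous_eval; fun_prop)
  have h2 : MemLpLoc 1 fun η => ∑ l, conj (D.b j l η) * D.b' j l (η + 2 * Real.pi * m / D.d j) :=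
    MemLpLoc.finsetSum _ fun l => (D.filter_b j l).2.star.mul ((D.filter_b' j l).2.comp_add _)
  refine (h1.add h2).sub ?_
  split_ifs
  · exact D.memLpLoc_Th (j + 1)
  · exact memLpLoc_of_continuous continuous_const 1

lemma continuous_tailKernel (j : ℕ) (c : ℝ) : Continuous (D.tailKernel j c) := by
  have h1 := (D.mask.differentiable_tailProd j).continuous
  have h2 := (D.mask'.differentiable_tailProd j).continuous
  unfold tailKernel
  fun_prop

lemma ae_tailKernel_ne_zero (j : ℕ) (c : ℝ) : ∀ᵐ x : ℝ, D.tailKernel j c x ≠ 0 := by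
  filter_upwards [D.mask.ae_tailProd_ne_zero j,
    (measurePreserving_add_right volume c).quasiMeasurePreserving.ae
      (D.mask'.ae_tailProd_ne_zero j)] with x h1 h2
  exact mul_ne_zero ((map_ne_zero _).2 h1) h2

/-- Take `f` supported in a small ball and `g` equal to 1 on its translate by `m * c`: only the
`m`-th integral survives. As `f` is arbitrary there, kernel times defect vanishes a.e. on the ball.
-/
lemma ae_defect_eq_zero_of_sum_eq (j : ℕ)
    (h : ∀ f g, D.sumPhi j f g + D.sumPsi j f g = D.sumPhi (j + 1) f g) (m : ℤ) :
    ∀ᵐ η : ℝ, D.defect j m η = 0 := by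
  have hlam := D.lam_ne j
  set c : ℝ := 2 * Real.pi / D.lam j with hc
  have hc0 : c ≠ 0 := div_ne_zero (by positivity) hlam
  have hshift : ∀ n : ℤ, 2 * Real.pi * n / D.lam j = n * c := fun n => by rw [hc]; ring
  -- Distinct shifts differ by at least `4ε`, and `x` is within `ε` of `x₀`, so the other translates
  -- are more than `3ε` from the centre of `g`, which vanishes from `2ε` on.
  set ε : ℝ := |c| / 4 with hεdef
  have hε : 0 < ε := by have := abs_pos.2 hc0; positivity
  set W : ℝ → ℂ := fun x => D.tailKernel (j + 1) (m * c) x * D.defect j m (D.lam (j + 1) * x)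
    with hW
  have hWint : LocallyIntegrable W volume := by
    have := (((D.memLpLoc_defect j m).comp_mul (D.lam_ne (j + 1))).mul_continuous
      (D.continuous_tailKernel (j + 1) (m * c))).locallyIntegrable_of_one
    simpa only [hW, mul_comm] using this
  have hloc : ∀ x₀ : ℝ, ∀ᵐ x : ℝ, x ∈ Metric.ball x₀ ε → W x = 0 := by
    intro x₀
    refine Metric.isOpen_ball.ae_eq_zero_of_integral_contDiff_smul_eq_zero
      (hWint.locallyIntegrableOn _) fun u hu huc hus => ?_
    let f : TestFun := ofRealTest u hu huc
    have hf : ∀ x, ¬ |x - x₀| < ε → f x = 0 := fun x hx => by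
      have : u x = 0 := image_eq_zero_of_notMem_tsupport fun h => hx (hus h)
      rw [ofRealTest_apply, this, Complex.ofReal_zero]
    obtain ⟨g, hg1, hg0⟩ := exists_testFun_eq_one (x₀ + m * c) hε
    have hs := D.hasSum_defectKernel j f g
    rw [h f g, sub_self, zero_div] at hs
    have hs' := hasSum_single (f := fun n : ℤ => ∫ x, D.defectKernel j f g n x) m fun n hn => by
      refine integral_eq_zero_of_ae (Eventually.of_forall fun x => ?_)
      by_cases hx : |x - x₀| < ε
      · rw [defectKernel, hshift, hg0]
        · simp
        · have h1 : (1 : ℝ) ≤ |(n : ℝ) - m| := by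
            rw [← Int.cast_sub, ← Int.cast_abs]
            exact_mod_cast Int.one_le_abs (sub_ne_zero.2 hn)
          have h2 : 4 * ε ≤ |((n : ℝ) - m) * c| := by
            rw [abs_mul, hεdef]
            have := abs_nonneg c
            nlinarith
          have h3 : ((n : ℝ) - m) * c = (x + n * c - (x₀ + m * c)) - (x - x₀) := by ring
          have h4 := abs_sub (x + n * c - (x₀ + m * c)) (x - x₀)
          rw [← h3] at h4
          linarith
      · simp [defectKernel, hf x hx]
    have h0 := hs'.unique hs
    rw [← h0]
    refine integral_congr_ae (Eventually.of_forall fun x => ?_)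
    simp only [defectKernel, hshift]
    by_cases hx : |x - x₀| < ε
    · rw [hg1 _ (by rw [add_sub_add_right_eq_sub]; exact hx.le), map_one, one_mul]
      rfl
    · have : u x = 0 := image_eq_zero_of_notMem_tsupport fun h => hx (hus h)
      rw [hf x hx, this, zero_mul, zero_smul]
  have hWae : ∀ᵐ x : ℝ, W x = 0 := by
    -- Countably many balls, centred at the multiples of `ε`, cover the line.
    filter_upwards [ae_all_iff.2 fun q : ℤ => hloc (q * ε)] with x hx
    refine hx ⌊x / ε⌋ ?_
    have h1 := Int.floor_le (x / ε)
    have h2 := Int.lt_floor_add_one (x / ε)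
    rw [le_div_iff₀ hε] at h1
    rw [div_lt_iff₀ hε] at h2
    rw [Metric.mem_ball, Real.dist_eq, abs_of_nonneg (by linarith)]
    linarith
  rw [← ae_comp_mul_iff (D.lam_ne (j + 1))]
  filter_upwards [hWae, D.ae_tailKernel_ne_zero (j + 1) (m * c)] with x h1 h2
  exact (mul_eq_zero.1 h1).resolve_left h2

lemma sum_eq_of_ae_defect_eq_zero (j : ℕ) (h : ∀ m, ∀ᵐ η : ℝ, D.defect j m η = 0)
    (f g : TestFun) : D.sumPhi j f g + D.sumPsi j f g = D.sumPhi (j + 1) f g := by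
  have hs := D.hasSum_defectKernel j f g
  have h0 : ∀ m, ∫ x, D.defectKernel j f g m x = 0 := fun m => by
    refine integral_eq_zero_of_ae ?_
    filter_upwards [(ae_comp_mul_iff (D.lam_ne (j + 1))).2 (h m)] with x hx
    simp [defectKernel, hx]
  simp only [h0] at hs
  have := hs.unique hasSum_zero
  have hπ : (2 * Real.pi : ℂ) ≠ 0 :=
    mul_ne_zero two_ne_zero (Complex.ofReal_ne_zero.2 Real.pi_ne_zero)
  rw [div_eq_zero_iff, or_iff_left hπ, sub_eq_zero] at this
  exact this

/-- The perfect reconstruction equations say that all defects vanish. -/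
lemma ae_defect_eq_zero_iff (j : ℕ) :
    (∀ m, ∀ᵐ η : ℝ, D.defect j m η = 0) ↔
      (∀ᵐ ξ : ℝ, D.Th j (D.d j * ξ) * conj ((D.a j).eval ξ) * (D.a' j).eval ξ +
          ∑ l, conj (D.b j l ξ) * D.b' j l ξ = D.Th (j + 1) ξ) ∧
      ∀ ω : ℤ, ¬ D.d j ∣ ω → ∀ᵐ ξ : ℝ,
        D.Th j (D.d j * ξ) * conj ((D.a j).eval ξ) *
            (D.a' j).eval (ξ + 2 * Real.pi * ω / D.d j) +
          ∑ l, conj (D.b j l ξ) * D.b' j l (ξ + 2 * Real.pi * ω / D.d j) = 0 := by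
  constructor
  · refine fun h => ⟨?_, fun ω hω => ?_⟩
    · filter_upwards [h 0] with ξ hξ
      simpa [defect, sub_eq_zero] using hξ
    · filter_upwards [h ω] with ξ hξ
      simpa [defect, hω] using hξ
  · rintro ⟨h1, h2⟩ m
    -- When `d j` divides `m`, the shift is a period of masks and filters, so all these cases are
    -- the case `m = 0`.
    by_cases hm : D.d j ∣ m
    · obtain ⟨n, rfl⟩ := hm
      have hd : (D.d j : ℝ) ≠ 0 := Int.cast_ne_zero.2 (D.d_ne j)
      have hn : 2 * Real.pi * ((D.d j * n : ℤ) : ℝ) / D.d j = 2 * Real.pi * n := by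
        push_cast; field_simp
      filter_upwards [h1] with ξ hξ
      simp only [defect, hn, (D.a' j).eval_add_int_mul, dvd_mul_right, if_true, sub_eq_zero,
        fun l => periodic_add_int (D.filter_b' j l).1 ξ n]
      exact hξ
    · filter_upwards [h2 m hm] with ξ hξ
      simpa [defect, hm] using hξ

end OEPData

/-! ### The limit at fine scales. -/

lemma tendstoDistrib_iff {u : ℕ → ℝ → ℂ} :
    TendstoDistrib u (fun _ => 1) ↔
      ∀ f : TestFun, Tendsto (fun j => ∫ x, u j x * f x) atTop (𝓝 (∫ x, f x)) := by
  constructor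
  · intro h f
    simpa [pair] using h (conjTest f)
  · intro h f
    simpa [pair] using h (conjTest f)

namespace OEPData

variable (D : OEPData)

/-- The entire function that restricts to `conj (φ^J(λ_J x)) φ'^J(λ_J x)`. -/
def tailHol (J : ℕ) (z : ℂ) : ℂ :=
  conj (tailProd D.d D.a J (conj z)) * tailProd D.d D.a' J z

lemma tailHol_ofReal (J : ℕ) (x : ℝ) : D.tailHol J x = D.tailKernel J 0 x := by
  simp [tailHol, tailKernel]

lemma differentiable_tailHol (J : ℕ) : Differentiable ℂ (D.tailHol J) := fun z => by
  have h1 : DifferentiableAt ℂ (fun z => conj (tailProd D.d D.a J (conj z))) z := by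
    have := (D.mask.differentiable_tailProd J (conj z)).conj_conj
    rw [RCLike.conj_conj] at this
    exact this
  exact h1.mul (D.mask'.differentiable_tailProd J z)

/-- A positive null sequence that bounds `|tailHol J - 1|` on the disc of radius `R`. -/
def holBound (R : ℝ) (J : ℕ) : ℝ :=
  tailBound D.d D.a R J + tailBound D.d D.a' R J +
    tailBound D.d D.a R J * tailBound D.d D.a' R J + 1 / ((J : ℝ) + 1)

lemma tendsto_holBound (R : ℝ) : Tendsto (D.holBound R) atTop (𝓝 0) := by
  have h1 := tendsto_tailBound D.d D.a R
  have h2 := tendsto_tailBound D.d D.a' R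
  have h3 := ((h1.add h2).add (h1.mul h2)).add
    (tendsto_one_div_add_atTop_nhds_zero_nat (𝕜 := ℝ))
  simp only [add_zero, mul_zero] at h3
  exact h3

lemma norm_tailHol_sub_one_le (J : ℕ) {R : ℝ} {z : ℂ} (hz : ‖z‖ ≤ R) :
    ‖D.tailHol J z - 1‖ ≤ D.holBound R J := by
  have h1 : ‖conj (tailProd D.d D.a J (conj z)) - 1‖ ≤ tailBound D.d D.a R J := by
    have := D.mask.norm_tailProd_sub_one_le J (R := R) (z := conj z)
      (by rwa [RCLike.norm_conj])
    rwa [← RCLike.norm_conj, map_sub, map_one] at this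
  have h2 := D.mask'.norm_tailProd_sub_one_le J hz
  set p := conj (tailProd D.d D.a J (conj z)) with hp
  set q := tailProd D.d D.a' J z with hq
  have : D.tailHol J z - 1 = (p - 1) + (q - 1) + (p - 1) * (q - 1) := by
    rw [tailHol, ← hp, ← hq]; ring
  rw [this, holBound]
  refine (norm_add₃_le).trans ?_
  rw [norm_mul]
  have h3 := mul_le_mul h1 h2 (norm_nonneg _) ((norm_nonneg _).trans h1)
  have : 0 ≤ 1 / ((J : ℝ) + 1) := by positivity
  linarith

/-- The summand `1 / (J + 1)` secures strict positivity, since the uniform boundedness argument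
divides by this bound. -/
lemma holBound_pos (J : ℕ) {R : ℝ} (hR : 0 ≤ R) : 0 < D.holBound R J := by
  have h1 := (norm_nonneg _).trans
    (D.mask.norm_tailProd_sub_one_le J (z := 0) (R := R) (by simpa using hR))
  have h2 := (norm_nonneg _).trans
    (D.mask'.norm_tailProd_sub_one_le J (z := 0) (R := R) (by simpa using hR))
  unfold holBound
  positivity

lemma locallyIntegrable_Th (J : ℕ) : LocallyIntegrable (fun x => D.Th J (D.lam J * x)) volume :=
  ((D.memLpLoc_Th J).comp_mul (D.lam_ne J)).locallyIntegrable_of_one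

lemma locallyIntegrable_Th_mul (J : ℕ) :
    LocallyIntegrable (fun x => D.Th J (D.lam J * x) * D.tailKernel J 0 x) volume :=
  (((D.memLpLoc_Th J).comp_mul (D.lam_ne J)).mul_continuous
    (D.continuous_tailKernel J 0)).locallyIntegrable_of_one

lemma _root_.Filter.Tendsto.exists_norm_le {u : ℕ → ℂ} {l : ℂ} (h : Tendsto u atTop (𝓝 l)) :
    ∃ C, ∀ j, ‖u j‖ ≤ C := by
  obtain ⟨C, hC⟩ := (Metric.isBounded_range_of_tendsto u h).exists_norm_le
  exact ⟨C, fun j => hC _ ⟨j, rfl⟩⟩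

/-- In the limit of `Θ^J(λ_J ·)` in the sense of distributions the refinable functions may be
inserted or removed. -/
theorem tendsto_Th_iff :
    (∀ f : TestFun, Tendsto (fun J => ∫ x, D.Th J (D.lam J * x) * f x) atTop (𝓝 (∫ x, f x))) ↔
    ∀ f : TestFun, Tendsto (fun J => ∫ x, D.Th J (D.lam J * x) * D.tailKernel J 0 x * f x) atTop
      (𝓝 (∫ x, f x)) := by
  have hsupp : ∀ f : TestFun, ∃ R, 0 ≤ R ∧ ∀ x ∈ tsupport f, ((x : ℝ) : ℂ) ∈ Metric.ball (0 : ℂ) R := by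
    intro f
    obtain ⟨R, hR⟩ := (f.hasCompactSupport : IsCompact (tsupport f)).isBounded.exists_norm_le
    refine ⟨|R| + 1, by positivity, fun x hx => ?_⟩
    rw [mem_ball_zero_iff, Complex.norm_real]
    linarith [hR x hx, le_abs_self R]
  constructor
  · intro h f
    obtain ⟨R, hR0, hR⟩ := hsupp f
    -- Convergent sequences are bounded, which is the pointwise boundedness needed; the error factor
    -- is `tailHol - 1`.
    have h1 := tendsto_integral_mul_hol D.locallyIntegrable_Th (fun f => (h f).exists_norm_le) f
      Metric.isOpen_ball hR (E := fun J z => D.tailHol J z - 1)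
      (fun J => ((D.differentiable_tailHol J).sub_const 1).differentiableOn)
      (fun J => D.holBound_pos J hR0)
      (fun J z hz => D.norm_tailHol_sub_one_le J (mem_ball_zero_iff.1 hz).le)
      (D.tendsto_holBound R)
    have h2 := h1.add (h f)
    rw [zero_add] at h2
    refine h2.congr fun J => ?_
    rw [← integral_add]
    · refine integral_congr_ae (Eventually.of_forall fun x => ?_)
      simp only [tailHol_ofReal]
      ring
    · exact (D.locallyIntegrable_Th J).integrable_mul_testFun (mulHol f Metric.isOpen_ball hR
        ((D.differentiable_tailHol J).sub_const 1).differentiableOn)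
    · exact (D.locallyIntegrable_Th J).integrable_mul_testFun f
  · intro h f
    obtain ⟨R, hR0, hR⟩ := hsupp f
    -- From level `N` on, `tailHol` is within `1/2` of 1 on the disc, hence invertible there. The
    -- error factor is now `tailHol⁻¹ - 1`, bounded by twice `holBound`.
    obtain ⟨N, hN⟩ := eventually_atTop.1
      ((D.tendsto_holBound R).eventually_le_const (show (0 : ℝ) < 1 / 2 by norm_num))
    have hge : ∀ J, ∀ z ∈ Metric.ball (0 : ℂ) R, 1 / 2 ≤ ‖D.tailHol (J + N) z‖ := by
      intro J z hz
      have h1 := (D.norm_tailHol_sub_one_le (J + N) (mem_ball_zero_iff.1 hz).le).trans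
        (hN (J + N) (Nat.le_add_left N J))
      have h2 := norm_sub_norm_le (1 : ℂ) (1 - D.tailHol (J + N) z)
      rw [norm_sub_rev 1, sub_sub_cancel, norm_one] at h2
      linarith
    have hne : ∀ J, ∀ z ∈ Metric.ball (0 : ℂ) R, D.tailHol (J + N) z ≠ 0 := fun J z hz h0 => by
      have := hge J z hz
      rw [h0, norm_zero] at this
      norm_num at this
    have hd : ∀ J, DifferentiableOn ℂ (fun z => (D.tailHol (J + N) z)⁻¹ - 1)
        (Metric.ball (0 : ℂ) R) := fun J =>
      ((D.differentiable_tailHol (J + N)).differentiableOn.inv (hne J)).sub_const 1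
    have h1 := tendsto_integral_mul_hol (fun J => D.locallyIntegrable_Th_mul (J + N))
      (fun f => ((tendsto_add_atTop_iff_nat N).2 (h f)).exists_norm_le) f
      Metric.isOpen_ball hR hd (ε := fun J => 2 * D.holBound R (J + N))
      (fun J => mul_pos two_pos (D.holBound_pos _ hR0))
      (fun J z hz => by
        have h0 := hne J z hz
        have h2 : (D.tailHol (J + N) z)⁻¹ - 1 =
            -(D.tailHol (J + N) z - 1) / D.tailHol (J + N) z := by field_simp; ring
        have h3 := D.norm_tailHol_sub_one_le (J + N) (mem_ball_zero_iff.1 hz).le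
        have h4 := hge J z hz
        rw [h2, norm_div, norm_neg, div_le_iff₀ (norm_pos_iff.2 h0)]
        have := D.holBound_pos (J + N) hR0
        nlinarith)
      (by simpa using ((tendsto_add_atTop_iff_nat N).2 (D.tendsto_holBound R)).const_mul 2)
    have h2 := h1.add ((tendsto_add_atTop_iff_nat N).2 (h f))
    rw [zero_add] at h2
    refine (tendsto_add_atTop_iff_nat N).1 (h2.congr fun J => ?_)
    rw [← integral_add]
    · refine integral_congr_ae (Eventually.of_forall fun x => ?_)
      by_cases hx : x ∈ tsupport f
      · have h0 := hne J x (hR x hx)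
        rw [tailHol_ofReal] at h0
        simp only [tailHol_ofReal]
        field_simp
        ring
      · simp [image_eq_zero_of_notMem_tsupport hx]
    · exact (D.locallyIntegrable_Th_mul (J + N)).integrable_mul_testFun
        (mulHol f Metric.isOpen_ball hR (hd J))
    · exact (D.locallyIntegrable_Th_mul (J + N)).integrable_mul_testFun f

/-- At fine scales only the central term of the frame sum of `Φ^J` survives. -/
lemma eventually_sumPhi_eq (f g : TestFun) : ∀ᶠ J in atTop, D.sumPhi J f g =
    2 * Real.pi * ∫ x, D.Th J (D.lam J * x) * D.tailKernel J 0 x * (f x * conj (g x)) := by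
  obtain ⟨R₁, h₁⟩ := exists_bound_support f
  obtain ⟨R₂, h₂⟩ := exists_bound_support g
  -- Once `λ_J` is small, every nonzero shift `2πm/λ_J` exceeds `|R₁| + |R₂|` and separates the
  -- supports.
  have hlim := (tendsto_scale D.tendsto_prod).abs.const_mul (|R₁| + |R₂|)
  rw [abs_zero, mul_zero] at hlim
  filter_upwards [hlim.eventually_lt_const (show (0 : ℝ) < 2 * Real.pi by positivity)] with J hJ
  have hl := abs_pos.2 (D.lam_ne J)
  have hs := hasSum_frameKernel (D.lam_ne J) (D.memLpLoc_phi J) (D.memLpLoc_phi' J) f g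
  have hs' := hasSum_single (f := fun m : ℤ => ∫ x, ∑ l, frameKernel (D.lam J)
      (genPhi D.d D.a D.θ J l) (genPhi D.d D.a' D.θ' J l) f g m x) 0 fun m hm => by
    refine integral_eq_zero_of_ae (Eventually.of_forall fun x => ?_)
    simp only [sum_frameKernel_phi]
    by_cases hx : R₁ < |x|
    · simp [h₁ x hx]
    · rw [h₂, map_zero, zero_mul, mul_zero]
      · rfl
      · have hm1 : (1 : ℝ) ≤ |(m : ℝ)| := by
          rw [← Int.cast_abs]
          exact_mod_cast Int.one_le_abs hm
        have h3 : |R₁| + |R₂| < |2 * Real.pi * m / D.lam J| := by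
          rw [abs_div, lt_div_iff₀ hl, abs_mul, abs_of_pos (by positivity : 0 < 2 * Real.pi)]
          nlinarith [Real.pi_pos]
        have h4 := abs_sub (x + 2 * Real.pi * m / D.lam J) x
        rw [add_sub_cancel_left] at h4
        have := le_abs_self R₁
        have := le_abs_self R₂
        linarith
  have h3 := hs'.unique hs
  have hπ : (2 * Real.pi : ℂ) ≠ 0 :=
    mul_ne_zero two_ne_zero (Complex.ofReal_ne_zero.2 Real.pi_ne_zero)
  rw [eq_div_iff hπ] at h3
  rw [sumPhi, ← h3, mul_comm]
  congr 1
  refine integral_congr_ae (Eventually.of_forall fun x => ?_)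
  simp only [sum_frameKernel_phi, Int.cast_zero, mul_zero, zero_div, add_zero]
  ring

/-- The frame sums of `Φ^J` tend to `2π⟨f, g⟩` exactly if `Θ^J(λ_J ·)` tends to `1` in the sense of
distributions. -/
theorem tendsto_sumPhi_iff :
    (∀ f g : TestFun, Tendsto (fun J => D.sumPhi J f g) atTop (𝓝 (2 * Real.pi * pair f g))) ↔
      TendstoDistrib (fun j ξ => D.Th j (D.lam j * ξ)) (fun _ => 1) := by
  rw [tendstoDistrib_iff, tendsto_Th_iff]
  have hπ : (2 * Real.pi : ℂ) ≠ 0 :=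
    mul_ne_zero two_ne_zero (Complex.ofReal_ne_zero.2 Real.pi_ne_zero)
  constructor
  · intro h f
    obtain ⟨R, hR⟩ := exists_bound_support f
    -- With `g = 1` on the support of `f`, the product `f · conj g` is `f`, so pairs of test
    -- functions reach every single one.
    obtain ⟨g, hg, -⟩ := exists_testFun_eq_one 0 (ε := |R| + 1) (by positivity)
    have hfg : ∀ x, f x * conj (g x) = f x := fun x => by
      by_cases hx : R < |x|
      · rw [hR x hx, zero_mul]
      · rw [hg x, map_one, mul_one]
        rw [sub_zero]
        linarith [le_abs_self R]
    have h1 := (((h f g).congr' (D.eventually_sumPhi_eq f g)).const_mul (2 * Real.pi : ℂ)⁻¹)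
    simpa only [inv_mul_cancel_left₀ hπ, hfg, pair] using h1
  · intro h f g
    refine Tendsto.congr' ((D.eventually_sumPhi_eq f g).mono fun J hJ => hJ.symm) ?_
    exact (h (mkTest (fun x => f x * conj (g x)) (f.contDiff.mul (conjTest g).contDiff)
      f.hasCompactSupport.mul_right)).const_mul _

/-! ### Telescoping and the equivalence. -/

/-- The family of systems generated by the data at the starting level `J`. -/
abbrev IsFrame (J : ℕ) : Prop :=
  IsNonstatDualFrames D.lam J (genPhi D.d D.a D.θ J) (genPhi D.d D.a' D.θ' J)
    (genPsi D.d D.a D.b) (genPsi D.d D.a' D.b')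

/-- Local integrability and absolute convergence are automatic for `L_{2,loc}` generators; only the
limit is a condition. -/
theorem isFrame_iff (J : ℕ) : D.IsFrame J ↔ ∀ f g : TestFun,
    Tendsto (fun J' : ℕ => D.sumPhi J f g + ∑ j ∈ Finset.Ico J J', D.sumPsi j f g) atTop
      (𝓝 (2 * Real.pi * pair f g)) :=
  ⟨fun h => h.tendsto_sum, fun h =>
    { locInt_φ := fun l => (D.memLpLoc_phi J l).locallyIntegrable
      locInt_φ' := fun l => (D.memLpLoc_phi' J l).locallyIntegrable
      locInt_ψ := fun j _ l => (D.memLpLoc_psi j l).locallyIntegrable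
      locInt_ψ' := fun j _ l => (D.memLpLoc_psi' j l).locallyIntegrable
      summable_φ := fun f g l =>
        summable_norm_frameTerm (D.lam_ne J) (D.memLpLoc_phi J l) (D.memLpLoc_phi' J l) f g
      summable_ψ := fun f g j _ l =>
        summable_norm_frameTerm (D.lam_ne j) (D.memLpLoc_psi j l) (D.memLpLoc_psi' j l) f g
      tendsto_sum := h }⟩

lemma sumPhi_add_sum_sumPsi
    (h : ∀ j f g, D.sumPhi j f g + D.sumPsi j f g = D.sumPhi (j + 1) f g) {J J' : ℕ} (hJ : J ≤ J')
    (f g : TestFun) :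
    D.sumPhi J f g + ∑ j ∈ Finset.Ico J J', D.sumPsi j f g = D.sumPhi J' f g := by
  induction J', hJ using Nat.le_induction with
  | base => simp
  | succ n hn ih => rw [Finset.sum_Ico_succ_top hn, ← add_assoc, ih, h]

theorem forall_isFrame_iff : (∀ J, D.IsFrame J) ↔
    (∀ j m, ∀ᵐ η : ℝ, D.defect j m η = 0) ∧
      TendstoDistrib (fun j ξ => D.Th j (D.lam j * ξ)) (fun _ => 1) := by
  simp only [isFrame_iff]
  rw [← tendsto_sumPhi_iff]
  constructor
  · intro h
    have hsum : ∀ j f g, D.sumPhi j f g + D.sumPsi j f g = D.sumPhi (j + 1) f g := by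
      intro j f g
      -- Both starting levels have the same limit, while their partial sums differ by a quantity
      -- independent of `J'`, which must therefore be zero.
      have h1 := (h j f g).sub (h (j + 1) f g)
      rw [sub_self] at h1
      rw [← sub_eq_zero]
      refine tendsto_nhds_unique (tendsto_const_nhds.congr' ?_) h1
      filter_upwards [eventually_ge_atTop (j + 1)] with J' hJ'
      rw [Finset.sum_eq_sum_Ico_succ_bot (by omega)]
      ring
    refine ⟨fun j m => D.ae_defect_eq_zero_of_sum_eq j (hsum j) m, fun f g => ?_⟩
    refine (h 0 f g).congr fun J' => ?_
    exact D.sumPhi_add_sum_sumPsi hsum (Nat.zero_le J') f g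
  · rintro ⟨h1, h2⟩ J f g
    have hsum := fun j => D.sum_eq_of_ae_defect_eq_zero j (h1 j)
    refine (h2 f g).congr' ?_
    filter_upwards [eventually_ge_atTop J] with J' hJ'
    exact (D.sumPhi_add_sum_sumPsi hsum hJ' f g).symm

end OEPData

end NonstatOEP

end

theorem mainTheorem4
    (d : ℕ → ℤ) (hd : ∀ j, d j ≠ 0)
    (hd_lim : Tendsto (fun j => ∏ n ∈ Finset.range j, |d n|) atTop atTop)
    (a a' : ℕ → TrigPoly)
    (ha0 : ∀ j, (a j).eval 0 = 1) (ha'0 : ∀ j, (a' j).eval 0 = 1)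
    (haC : Summable fun j => |scale d (j + 1)| * (a j).deg * (a j).normInf)
    (ha'C : Summable fun j => |scale d (j + 1)| * (a' j).deg * (a' j).normInf) :
    -- the infinite products converge and lie in `L_{∞,loc}`
    (∀ j ξ, Multipliable (refFactor d a j ξ)) ∧
    (∀ j ξ, Multipliable (refFactor d a' j ξ)) ∧
    (∀ j, MemLpLoc ∞ (refFun d a j)) ∧
    (∀ j, MemLpLoc ∞ (refFun d a' j)) ∧
    -- the nonstationary refinement equations
    (∀ (j : ℕ) (ξ : ℝ), refFun d a j (d j * ξ) = (a j).eval ξ * refFun d a (j + 1) ξ) ∧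
    (∀ (j : ℕ) (ξ : ℝ), refFun d a' j (d j * ξ) = (a' j).eval ξ * refFun d a' (j + 1) ξ) ∧
    -- the derived systems
    ∀ (r s : ℕ → ℕ) (θ θ' : ∀ j, Fin (r j) → ℝ → ℂ) (b b' : ∀ j, Fin (s j) → ℝ → ℂ),
      IsFilterFamily θ → IsFilterFamily θ' → IsFilterFamily b → IsFilterFamily b' →
      (∀ j l, MemLpLoc 2 (genPhi d a θ j l)) ∧
      (∀ j l, MemLpLoc 2 (genPhi d a' θ' j l)) ∧
      (∀ j l, MemLpLoc 2 (genPsi d a b j l)) ∧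
      (∀ j l, MemLpLoc 2 (genPsi d a' b' j l)) ∧
      ((∀ J : ℕ, IsNonstatDualFrames (scale d) J (genPhi d a θ J) (genPhi d a' θ' J)
          (genPsi d a b) (genPsi d a' b')) ↔
        (∀ j : ℕ,
          (∀ᵐ ξ : ℝ,
            bigTheta θ θ' j (d j * ξ) * conj ((a j).eval ξ) * (a' j).eval ξ +
              ∑ l, conj (b j l ξ) * b' j l ξ = bigTheta θ θ' (j + 1) ξ) ∧
          (∀ ω : ℤ, ¬ d j ∣ ω → ∀ᵐ ξ : ℝ,
            bigTheta θ θ' j (d j * ξ) * conj ((a j).eval ξ) *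
                (a' j).eval (ξ + 2 * Real.pi * ω / d j) +
              ∑ l, conj (b j l ξ) * b' j l (ξ + 2 * Real.pi * ω / d j) = 0)) ∧
        TendstoDistrib (fun j ξ => bigTheta θ θ' j (scale d j * ξ)) (fun _ => 1)) := by
  have ha : IsMaskSeq d a := ⟨ha0, haC⟩
  have ha' : IsMaskSeq d a' := ⟨ha'0, ha'C⟩
  refine ⟨fun j ξ => ?_, fun j ξ => ?_, fun j => memLpLoc_of_continuous (ha.continuous_refFun j) ∞,
    fun j => memLpLoc_of_continuous (ha'.continuous_refFun j) ∞, ha.refFun_mul hd, ha'.refFun_mul hd,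
    fun r s θ θ' b b' hθ hθ' hb hb' => ⟨memLpLoc_genPhi ha hθ, memLpLoc_genPhi ha' hθ',
      memLpLoc_genPsi hd ha hb, memLpLoc_genPsi hd ha' hb', ?_⟩⟩
  · rw [show refFactor d a j ξ = _ from funext (refFactor_eq d a j ξ)]
    exact ha.multipliable j _
  · rw [show refFactor d a' j ξ = _ from funext (refFactor_eq d a' j ξ)]
    exact ha'.multipliable j _
  · let D : OEPData := ⟨d, a, a', r, s, θ, θ', b, b', hd, hd_lim, ha, ha', hθ, hθ', hb, hb'⟩
    exact D.forall_isFrame_iff.trans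
      (and_congr_left' (forall_congr' fun j => D.ae_defect_eq_zero_iff j))
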